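/- Let $K$ be a field and let $\mathcal C$ be a skeletally small additive graded $K$-category: a $K$-linear category with finite direct sums in which every Hom-space is a $\mathbb Z$-graded $K$-vector space $\operatorname{Hom}_{\mathcal C}(X,Y)=\bigoplus_{i\in\mathbb Z}\operatorname{Hom}_{\mathcal C}(X,Y)_i$, such that identities have degree $0$ and degrees add under composition. Let $\operatorname{Gr}(\mathcal C)$ denote the category of graded $K$-linear functors $F\colon\mathcal C^{\mathrm{op}}\to\operatorname{Gr}(K)$ to $\mathbb Z$-graded $K$-vector spaces (so $f\in\operatorname{Hom}_{\mathcal C}(X,Y)_i$ induces linear maps $F(Y)_j\to F(X)_{i+j}$); simple objects, projective dimension and global dimension (the supremum of the projective dimensions of all objects) are taken in the abelian category of these functors and natural transformations of degree zero. The opposite category $\mathcal C^{\mathrm{op}}$ carries the same grading. The graded radical of a $\mathbb Z$-graded ring is the intersection of its maximal homogeneous left ideals, and the ring is graded local if it has exactly one such ideal. The radical of $\mathcal C$ is $$\operatorname{rad}_{\mathcal C}(X,Y)=\{f\in\operatorname{Hom}_{\mathcal C}(X,Y)\mid gf\text{ lies in the graded radical of }\operatorname{End}_{\mathcal C}(X)\text{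 for all }g\in\operatorname{Hom}_{\mathcal C}(Y,X)\}.$$ Assume that - $\mathcal C$ is positively graded: $\operatorname{Hom}_{\mathcal C}(X,Y)_i=0$ for all $X,Y$ and all $i<0$; - $\mathcal C$ is Krull-Schmidt: every object is a finite direct sum of objects with graded local endomorphism ring; - $\operatorname{rad}_{\mathcal C}(X,Y)=\bigoplus_{i\ge 1}\operatorname{Hom}_{\mathcal C}(X,Y)_i$ for all $X,Y$. Then: (a) For every integer $n\ge 0$: if every simple functor in $\operatorname{Gr}(\mathcal C^{\mathrm{op}})$ has projective dimension at most $n$, then $\operatorname{Gr}(\mathcal C)$ has global dimension at most $n$. (b) The global dimension of $\operatorname{Gr}(\mathcal C)$ is finite if and only if the global dimension of $\operatorname{Gr}(\mathcal C^{\mathrm{op}})$ is finite, and when one of the two global dimensions is finite, they are equal. -/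

import Mathlib

open CategoryTheory CategoryTheory.Limits

universe w v u

/-! ## Graded `K`-categories -/

/-- A graded `K`-category: a `K`-linear category whose Hom-spaces are `ℤ`-graded `K`-vector
spaces `Hom(X, Y) = ⨁ i, Hom(X, Y)_i`, the degrees being additive under composition. -/
class GradedLinearCategory (K : Type w) [Field K] (C : Type u) [Category.{v} C]
    [Preadditive C] [Linear K C] where
  /-- The homogeneous morphisms `X ⟶ Y` of degree `i`. -/
  homDeg : ∀ X Y : C, ℤ → Submodule K (X ⟶ Y)
  isInternal : ∀ X Y : C, DirectSum.IsInternal (homDeg X Y)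
  id_mem : ∀ X : C, 𝟙 X ∈ homDeg X X 0
  comp_mem : ∀ {X Y Z : C} {i j : ℤ} {f : X ⟶ Y} {g : Y ⟶ Z},
    f ∈ homDeg X Y i → g ∈ homDeg Y Z j → f ≫ g ∈ homDeg X Z (i + j)

namespace GradedLinearCategory

section Basic

variable (K : Type w) [Field K] (C : Type u) [Category.{v} C] [Preadditive C] [Linear K C]
  [GradedLinearCategory K C]

variable {C} in
/-- The grading of the endomorphism ring `End X`. -/
abbrev endDeg (X : C) : ℤ → Submodule K (End X) := homDeg (K := K) X X

/-- The endomorphism ring of an object of a graded category is a `ℤ`-graded ring. -/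
noncomputable instance gradedRingEnd (X : C) : GradedRing (endDeg K X) where
  one_mem := id_mem (K := K) X
  mul_mem := by
    intro i j f g hf hg
    have := comp_mem (K := K) (C := C) hg hf
    rw [add_comm] at this
    exact this
  toDecomposition := (isInternal (K := K) X X).chooseDecomposition

/-- `C` is positively graded: `Hom(X, Y) = ⨁ i ≥ 0, Hom(X, Y)_i`. -/
def IsPositivelyGraded : Prop :=
  ∀ (X Y : C) (i : ℤ), i < 0 → homDeg (K := K) X Y i = ⊥

end Basic

/-! ## Graded radical, graded local rings, Krull-Schmidt categories -/

section Radical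

/-- The graded (Jacobson) radical of a `ℤ`-graded ring: the intersection of all its maximal
homogeneous (= graded) left ideals, i.e. of the coatoms among homogeneous left ideals. -/
def gradedJacobson {K : Type w} {R : Type v} [Field K] [Ring R] [Algebra K R]
    (𝒜 : ℤ → Submodule K R) [GradedRing 𝒜] : Set R :=
  {r | ∀ I : HomogeneousIdeal 𝒜, IsCoatom I → r ∈ I}

/-- A `ℤ`-graded ring is graded local if it has exactly one maximal homogeneous left ideal. -/
def IsGradedLocal {K : Type w} {R : Type v} [Field K] [Ring R] [Algebra K R]
    (𝒜 : ℤ → Submodule K R) [GradedRing 𝒜] : Prop :=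
  ∃! I : HomogeneousIdeal 𝒜, IsCoatom I

variable (K : Type w) [Field K] (C : Type u) [Category.{v} C] [Preadditive C] [Linear K C]
  [GradedLinearCategory K C]

variable {C} in
/-- The radical of a graded category: `rad(X, Y)` consists of the morphisms `f : X ⟶ Y` such that
for all `g : Y ⟶ X` the composite `g ∘ f` lies in the (graded) radical of `End X`. -/
def gradedRad (X Y : C) : Set (X ⟶ Y) :=
  {f | ∀ g : Y ⟶ X, (f ≫ g : End X) ∈ gradedJacobson (endDeg K X)}

variable {C} in
/-- The positive-degree part `⨁ i ≥ 1, Hom(X, Y)_i` of `Hom(X, Y)`. -/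
def positivePart (X Y : C) : Submodule K (X ⟶ Y) :=
  ⨆ i : {i : ℤ // 1 ≤ i}, homDeg (K := K) X Y i

/-- A graded `K`-category is Krull-Schmidt if every object is a finite direct sum of objects with
graded local endomorphism ring. -/
def IsKrullSchmidt [HasFiniteBiproducts C] : Prop :=
  ∀ X : C, ∃ (n : ℕ) (Y : Fin n → C),
    Nonempty (X ≅ ⨁ Y) ∧ ∀ a, IsGradedLocal (endDeg K (Y a))

end Radical

/-! ## The opposite graded category -/

section Opposite

variable (K : Type w) [Field K] (C : Type u) [Category.{v} C] [Preadditive C] [Linear K C]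

/-- The opposite of a `K`-linear category is `K`-linear. -/
instance linearOp : Linear K Cᵒᵖ where
  homModule X Y :=
    { smul := fun r f => (r • f.unop).op
      one_smul := fun f => Quiver.Hom.unop_inj (one_smul K f.unop)
      mul_smul := fun r s f => Quiver.Hom.unop_inj (mul_smul r s f.unop)
      smul_zero := fun r => Quiver.Hom.unop_inj (smul_zero (A := (Y.unop ⟶ X.unop)) r)
      smul_add := fun r f g => Quiver.Hom.unop_inj (smul_add r f.unop g.unop)
      add_smul := fun r s f => Quiver.Hom.unop_inj (add_smul r s f.unop)
      zero_smul := fun f => Quiver.Hom.unop_inj (zero_smul K f.unop) }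
  smul_comp _ _ _ r f g := Quiver.Hom.unop_inj (Linear.comp_smul _ _ _ g.unop r f.unop)
  comp_smul _ _ _ f r g := Quiver.Hom.unop_inj (Linear.smul_comp _ _ _ r g.unop f.unop)

variable {C} in
/-- Taking the opposite morphism is a linear equivalence. -/
def opLinearEquiv (X Y : C) : (X ⟶ Y) ≃ₗ[K] (Opposite.op Y ⟶ Opposite.op X) where
  toFun f := f.op
  invFun f := f.unop
  map_add' _ _ := rfl
  map_smul' _ _ := rfl

/-- The opposite of a graded category, a morphism in `Cᵒᵖ` having the degree it has in `C`. -/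
instance gradedOp [GradedLinearCategory K C] : GradedLinearCategory K Cᵒᵖ where
  homDeg X Y i :=
    (homDeg (K := K) Y.unop X.unop i).map (opLinearEquiv K Y.unop X.unop).toLinearMap
  isInternal X Y := by
    have h := isInternal (K := K) Y.unop X.unop
    rw [DirectSum.isInternal_submodule_iff_iSupIndep_and_iSup_eq_top] at h ⊢
    refine ⟨?_, ?_⟩
    · exact h.1.map_orderIso (Submodule.orderIsoMapComap (opLinearEquiv K Y.unop X.unop))
    · rw [← Submodule.map_iSup, h.2, Submodule.map_top]
      exact LinearEquiv.range _
  id_mem X := ⟨𝟙 X.unop, id_mem X.unop, rfl⟩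
  comp_mem := by
    rintro X Y Z i j _ _ ⟨f, hf, rfl⟩ ⟨g, hg, rfl⟩
    refine ⟨g ≫ f, ?_, rfl⟩
    rw [add_comm]
    exact comp_mem hg hf

end Opposite

end GradedLinearCategory

open GradedLinearCategory

/-! ## The category of graded functors -/

/-- An object of `Gr(C)`: a graded (`K`-linear) functor `F : Cᵒᵖ ⥤ Gr(K)`. It consists of a graded
vector space `F(X) = (F(X)_i)_i` for every object `X`, and for every homogeneous morphism
`f : X ⟶ Y` of degree `i` of a linear map `F(f) : F(Y) → F(X)` of degree `i`, i.e. of linear maps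
`F(Y)_j → F(X)_{i + j}`, depending linearly on `f`. (On an arbitrary morphism, `F` is the sum
of its values on the homogeneous components.) -/
structure GrFunctor (K : Type w) [Field K] (C : Type u) [Category.{v} C] [Preadditive C]
    [Linear K C] [GradedLinearCategory K C] where
  obj : C → GradedObject ℤ (ModuleCat.{v} K)
  map : ∀ {X Y : C} {i j k : ℤ}, i + j = k →
    (homDeg (K := K) X Y i →ₗ[K] obj Y j →ₗ[K] obj X k)
  map_id : ∀ (X : C) (j : ℤ) (x : obj X j), map (zero_add j) ⟨𝟙 X, id_mem X⟩ x = x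
  map_comp : ∀ {X Y Z : C} {i j k l m : ℤ} (hl : j + k = l) (hm : i + l = m)
    (hm' : (i + j) + k = m) (f : homDeg (K := K) X Y i) (g : homDeg (K := K) Y Z j)
    (x : obj Z k), map hm' ⟨f.1 ≫ g.1, comp_mem f.2 g.2⟩ x = map hm f (map hl g x)

namespace GrFunctor

variable {K : Type w} [Field K] {C : Type u} [Category.{v} C] [Preadditive C] [Linear K C]
  [GradedLinearCategory K C]

/-- A morphism in `Gr(C)_0`: a natural transformation all of whose components `F(X) → G(X)` are
linear maps of degree zero. -/
@[ext]
structure Hom (F G : GrFunctor K C) where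
  app : ∀ (X : C) (i : ℤ), F.obj X i →ₗ[K] G.obj X i
  naturality : ∀ {X Y : C} {i j k : ℤ} (h : i + j = k) (f : homDeg (K := K) X Y i)
    (x : F.obj Y j), app X k (F.map h f x) = G.map h f (app Y j x)

/-- The category `Gr(C)_0` of graded functors and natural transformations of degree zero. -/
instance : Category (GrFunctor K C) where
  Hom := Hom
  id F := ⟨fun _ _ => LinearMap.id, fun _ _ _ => rfl⟩
  comp η θ := ⟨fun X i => (θ.app X i).comp (η.app X i), fun h f x => by
    simp [η.naturality, θ.naturality]⟩

@[ext]
lemma hom_ext {F G : GrFunctor K C} {η θ : F ⟶ G}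
    (h : ∀ X i (x : F.obj X i), η.app X i x = θ.app X i x) : η = θ :=
  Hom.ext (funext fun X => funext fun i => LinearMap.ext (h X i))

@[simp] lemma id_app (F : GrFunctor K C) (X : C) (i : ℤ) :
    Hom.app (𝟙 F) X i = LinearMap.id := rfl

@[simp] lemma comp_app {F G H : GrFunctor K C} (η : F ⟶ G) (θ : G ⟶ H) (X : C) (i : ℤ) :
    Hom.app (η ≫ θ) X i = (θ.app X i).comp (η.app X i) := rfl

section Preadditive

variable {F G : GrFunctor K C}

instance : Zero (F ⟶ G) := ⟨⟨fun _ _ => 0, fun _ _ _ => by simp⟩⟩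
instance : Add (F ⟶ G) := ⟨fun η θ => ⟨fun X i => η.app X i + θ.app X i, fun h f x => by
  simp [η.naturality, θ.naturality]⟩⟩
instance : Neg (F ⟶ G) := ⟨fun η => ⟨fun X i => -η.app X i, fun h f x => by
  simp [η.naturality]⟩⟩
instance : Sub (F ⟶ G) := ⟨fun η θ => ⟨fun X i => η.app X i - θ.app X i, fun h f x => by
  simp [η.naturality, θ.naturality]⟩⟩
instance : SMul ℕ (F ⟶ G) := ⟨fun n η => ⟨fun X i => n • η.app X i, fun h f x => by
  simp [η.naturality]⟩⟩
instance : SMul ℤ (F ⟶ G) := ⟨fun n η => ⟨fun X i => n • η.app X i, fun h f x => by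
  simp [η.naturality]⟩⟩

@[simp] lemma zero_app (X : C) (i : ℤ) : Hom.app (0 : F ⟶ G) X i = 0 := rfl
@[simp] lemma add_app (η θ : F ⟶ G) (X : C) (i : ℤ) :
    Hom.app (η + θ) X i = η.app X i + θ.app X i := rfl

instance : AddCommGroup (F ⟶ G) :=
  Function.Injective.addCommGroup (fun η : F ⟶ G => η.app) (fun _ _ h => Hom.ext h)
    rfl (fun _ _ => rfl) (fun _ => rfl) (fun _ _ => rfl) (fun _ _ => rfl) (fun _ _ => rfl)

end Preadditive

instance : Preadditive (GrFunctor K C) where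
  add_comp _ _ _ η θ ζ := by ext; simp
  comp_add _ _ _ η θ ζ := by ext; simp

/-! ### `Gr(C)_0` is an abelian category -/

section Kernels

variable {F G : GrFunctor K C}

/-- The kernel of a morphism, computed pointwise. -/
def ker (η : F ⟶ G) : GrFunctor K C where
  obj X i := ModuleCat.of K (LinearMap.ker (η.app X i))
  map {X Y i j k} h :=
    { toFun := fun f => (F.map h f).restrict fun x hx => by
        rw [LinearMap.mem_ker] at hx ⊢
        rw [η.naturality, hx, map_zero]
      map_add' := fun f g => LinearMap.ext fun x => Subtype.ext (by simp)
      map_smul' := fun r f => LinearMap.ext fun x => Subtype.ext (by simp) }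
  map_id X j x := Subtype.ext (F.map_id X j x.1)
  map_comp hl hm hm' f g x := Subtype.ext (F.map_comp hl hm hm' f g x.1)

/-- The inclusion of the kernel. -/
def kerι (η : F ⟶ G) : ker η ⟶ F :=
  ⟨fun X i => (LinearMap.ker (η.app X i)).subtype, fun _ _ _ => rfl⟩

lemma kerι_comp (η : F ⟶ G) : kerι η ≫ η = 0 := by
  ext X i x
  exact x.2

/-- The cokernel of a morphism, computed pointwise. -/
def coker (η : F ⟶ G) : GrFunctor K C where
  obj X i := ModuleCat.of K (G.obj X i ⧸ LinearMap.range (η.app X i))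
  map {X Y i j k} h :=
    { toFun := fun f => Submodule.mapQ _ _ (G.map h f) (by
        rintro _ ⟨x, rfl⟩
        exact ⟨F.map h f x, η.naturality h f x⟩)
      map_add' := fun f g => by
        apply Submodule.linearMap_qext; ext x; simp
      map_smul' := fun r f => by
        apply Submodule.linearMap_qext; ext x; simp }
  map_id X j x := by
    obtain ⟨x, rfl⟩ := Submodule.mkQ_surjective _ x
    exact congrArg _ (G.map_id X j x)
  map_comp hl hm hm' f g x := by
    obtain ⟨x, rfl⟩ := Submodule.mkQ_surjective _ x
    exact congrArg _ (G.map_comp hl hm hm' f g x)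

/-- The projection onto the cokernel. -/
def cokerπ (η : F ⟶ G) : G ⟶ coker η :=
  ⟨fun X i => (LinearMap.range (η.app X i)).mkQ, fun _ _ _ => rfl⟩

lemma comp_cokerπ (η : F ⟶ G) : η ≫ cokerπ η = 0 := by
  ext X i x
  exact (Submodule.Quotient.mk_eq_zero _).2 ⟨x, rfl⟩

end Kernels

lemma app_injective_of_mono {F G : GrFunctor K C} (η : F ⟶ G) [Mono η] (X : C) (i : ℤ) :
    Function.Injective (η.app X i) := by
  rw [injective_iff_map_eq_zero]
  intro x hx
  have h0 : kerι η = 0 := by rw [← cancel_mono η, kerι_comp, zero_comp]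
  have := congrArg (fun θ : ker η ⟶ F => θ.app X i ⟨x, hx⟩) h0
  exact this

lemma app_surjective_of_epi {F G : GrFunctor K C} (η : F ⟶ G) [Epi η] (X : C) (i : ℤ) :
    Function.Surjective (η.app X i) := by
  intro y
  have h0 : cokerπ η = 0 := by rw [← cancel_epi η, comp_cokerπ, comp_zero]
  have := congrArg (fun θ : G ⟶ coker η => θ.app X i y) h0
  exact (Submodule.Quotient.mk_eq_zero _).1 this

/-- A pointwise injective morphism whose image is pointwise the kernel of `η` is a kernel. -/
noncomputable def isLimitOfExact {E F G : GrFunctor K C} (ι : E ⟶ F) (η : F ⟶ G) (w : ι ≫ η = 0)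
    (inj : ∀ X i, Function.Injective (ι.app X i))
    (ex : ∀ X i x, η.app X i x = 0 → x ∈ LinearMap.range (ι.app X i)) :
    IsLimit (KernelFork.ofι ι w) := by
  have key : ∀ {W : GrFunctor K C} (θ : W ⟶ F) (_ : θ ≫ η = 0) (X : C) (i : ℤ) (x : W.obj X i),
      θ.app X i x ∈ LinearMap.range (ι.app X i) := fun θ h X i x =>
    ex X i _ (congrArg (fun ζ : _ ⟶ G => ζ.app X i x) h)
  have spec : ∀ X i (y : LinearMap.range (ι.app X i)),
      ι.app X i ((LinearEquiv.ofInjective (ι.app X i) (inj X i)).symm y) = y := fun X i y =>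
    congrArg Subtype.val ((LinearEquiv.ofInjective (ι.app X i) (inj X i)).apply_symm_apply y)
  refine KernelFork.IsLimit.ofι _ _
    (fun {W} θ h => ⟨fun X i => (LinearEquiv.ofInjective (ι.app X i) (inj X i)).symm.toLinearMap.comp
      ((θ.app X i).codRestrict _ (key θ h X i)), fun {X Y i j k} hk f x => ?_⟩) ?_ ?_
  · apply inj X k
    rw [ι.naturality]
    simp only [LinearMap.comp_apply, LinearEquiv.coe_coe, spec, LinearMap.codRestrict_apply]
    exact θ.naturality hk f x
  · intro W θ h
    ext X i x
    exact spec X i _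
  · intro W θ h m hm
    ext X i x
    apply inj X i
    refine Eq.trans ?_ (spec X i _).symm
    exact congrArg (fun ζ : _ ⟶ F => ζ.app X i x) hm

/-- A pointwise surjective morphism whose kernel is pointwise the image of `η` is a cokernel. -/
noncomputable def isColimitOfExact {E F G : GrFunctor K C} (η : E ⟶ F) (π : F ⟶ G) (w : η ≫ π = 0)
    (surj : ∀ X i, Function.Surjective (π.app X i))
    (ex : ∀ X i x, π.app X i x = 0 → x ∈ LinearMap.range (η.app X i)) :
    IsColimit (CokernelCofork.ofπ π w) := by
  have key : ∀ {W : GrFunctor K C} (θ : F ⟶ W) (_ : η ≫ θ = 0) (X : C) (i : ℤ),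
      LinearMap.ker (π.app X i) ≤ LinearMap.ker (θ.app X i) := fun θ h X i x hx => by
    obtain ⟨y, rfl⟩ := ex X i x hx
    exact congrArg (fun ζ : E ⟶ _ => ζ.app X i y) h
  have spec : ∀ X i (x : F.obj X i),
      ((π.app X i).quotKerEquivOfSurjective (surj X i)).symm (π.app X i x)
        = (LinearMap.ker (π.app X i)).mkQ x := fun X i x => by
    rw [LinearEquiv.symm_apply_eq]
    rfl
  refine CokernelCofork.IsColimit.ofπ _ _
    (fun {W} θ h => ⟨fun X i => ((LinearMap.ker (π.app X i)).liftQ (θ.app X i) (key θ h X i)).comp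
      ((π.app X i).quotKerEquivOfSurjective (surj X i)).symm.toLinearMap,
      fun {X Y i j k} hk f x => ?_⟩) ?_ ?_
  · obtain ⟨x, rfl⟩ := surj Y j x
    rw [← π.naturality]
    simp only [LinearMap.comp_apply, LinearEquiv.coe_coe, spec]
    exact θ.naturality hk f x
  · intro W θ h
    ext X i x
    simp only [comp_app, LinearMap.comp_apply, LinearEquiv.coe_coe, spec]
    rfl
  · intro W θ h m hm
    ext X i x
    obtain ⟨x, rfl⟩ := surj X i x
    simp only [LinearMap.comp_apply, LinearEquiv.coe_coe, spec]
    exact congrArg (fun ζ : F ⟶ _ => ζ.app X i x) hm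

instance : HasKernels (GrFunctor K C) where
  has_limit η := ⟨⟨_, isLimitOfExact (kerι η) η (kerι_comp η)
    (fun _ _ => Subtype.val_injective) (fun _ _ x hx => ⟨⟨x, hx⟩, rfl⟩)⟩⟩

instance : HasCokernels (GrFunctor K C) where
  has_colimit η := ⟨⟨_, isColimitOfExact η (cokerπ η) (comp_cokerπ η)
    (fun _ _ => Submodule.mkQ_surjective _)
    (fun _ _ _ hx => (Submodule.Quotient.mk_eq_zero _).1 hx)⟩⟩

instance : IsNormalMonoCategory (GrFunctor K C) where
  normalMonoOfMono η _ := ⟨⟨coker η, cokerπ η, comp_cokerπ η,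
    isLimitOfExact _ _ _ (app_injective_of_mono η)
      (fun _ _ _ hx => (Submodule.Quotient.mk_eq_zero _).1 hx)⟩⟩

instance : IsNormalEpiCategory (GrFunctor K C) where
  normalEpiOfEpi η _ := ⟨⟨ker η, kerι η, kerι_comp η,
    isColimitOfExact _ _ _ (app_surjective_of_epi η) (fun _ _ x hx => ⟨⟨x, hx⟩, rfl⟩)⟩⟩

/-- The zero functor. -/
def zeroFunctor : GrFunctor K C where
  obj _ _ := ModuleCat.of K PUnit
  map _ := 0
  map_id _ _ _ := rfl
  map_comp _ _ _ _ _ _ := rfl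

instance : HasZeroObject (GrFunctor K C) :=
  ⟨zeroFunctor, (IsZero.iff_id_eq_zero _).2 rfl⟩

/-- The direct sum of two graded functors. -/
def sum (F G : GrFunctor K C) : GrFunctor K C where
  obj X i := ModuleCat.of K (F.obj X i × G.obj X i)
  map h :=
    { toFun := fun f => (F.map h f).prodMap (G.map h f)
      map_add' := fun f g => LinearMap.ext fun x => Prod.ext (by simp) (by simp)
      map_smul' := fun r f => LinearMap.ext fun x => Prod.ext (by simp) (by simp) }
  map_id X j x := Prod.ext (F.map_id X j x.1) (G.map_id X j x.2)
  map_comp hl hm hm' f g x :=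
    Prod.ext (F.map_comp hl hm hm' f g x.1) (G.map_comp hl hm hm' f g x.2)

instance : HasBinaryBiproducts (GrFunctor K C) where
  has_binary_biproduct F G := hasBinaryBiproduct_of_total
    { pt := sum F G
      fst := ⟨fun _ _ => LinearMap.fst K _ _, fun _ _ _ => rfl⟩
      snd := ⟨fun _ _ => LinearMap.snd K _ _, fun _ _ _ => rfl⟩
      inl := ⟨fun _ _ => LinearMap.inl K _ _, fun h f _ => Prod.ext rfl (map_zero (G.map h f)).symm⟩
      inr := ⟨fun _ _ => LinearMap.inr K _ _, fun h f _ => Prod.ext (map_zero (F.map h f)).symm rfl⟩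
      inl_fst := rfl
      inl_snd := rfl
      inr_fst := rfl
      inr_snd := rfl } (by
    ext X i x
    exact Prod.ext (add_zero x.1) (zero_add x.2))

/-- Graded functors and natural transformations of degree zero form an abelian category. -/
noncomputable instance : Abelian (GrFunctor K C) where
  has_finite_products :=
    have : HasTerminal (GrFunctor K C) := inferInstance
    hasFiniteProducts_of_has_binary_and_terminal

end GrFunctor

/-- The global dimension of an abelian category: the supremum of the projective dimensions of its
objects. (A zero object has projective dimension `⊥`, and `⊤` stands for infinity.) -/
noncomputable def globalDimension (A : Type u) [Category.{v} A] [Abelian A] : WithBot ℕ∞ :=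
  ⨆ F : A, projectiveDimension F

/-!
The idea is to pass between the two sides by vector space duality and to detect projectivity by the
semisimple functors.

*Degree zero.* By the hypothesis on the radical, the endomorphisms of degree zero of an
indecomposable object form a division ring, and every nonzero morphism of degree zero from or to
an indecomposable object splits. This is a self-dual condition (`DegreeZeroSemisimple`). It implies
that a functor on which all morphisms of positive degree act as zero (`IsAnnihilated`) is
semisimple: its subfunctors have complements (`exists_complement`), and it is a direct summand of a
direct sum of simple functors, so its projective dimension is bounded by those of the simple ones
(`hasProjectiveDimensionLE_of_isAnnihilated`).

*Duality.* For a nonzero vector space `E`, the functor `S ↦ Hom_K(S, E)` from left to right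
functors is exact and takes projectives to injectives, so it takes projective dimension `≤ n` to
injective dimension `≤ n` (`hasInjectiveDimensionLE_dual`). An annihilated functor `G` is a direct
summand of its double dual. Hence, if simple functors in `Gr(Cᵒᵖ)` have projective dimension
`≤ n`, then all annihilated functors in `Gr(C)` have injective dimension `≤ n`, that is,
`Ext^{n+1}(M, G) = 0` for every `M`.

*Bounded below functors.* After dimension shifting, let `M` be bounded below with `Ext¹(M, G) = 0`
for all annihilated `G`. There is an epimorphism onto `M` from a bounded below projective functor;
its kernel is filtered by degree with annihilated subquotients, and a section can be built one
degree at a time, so `M` is projective (`projective_of_ext_eq_zero`). Thus bounded below functors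
have projective dimension `≤ n`.

*All functors.* Dually, a functor `G` with `Ext¹(B, G) = 0` for all bounded below `B` is injective,
since morphisms to `G` can be extended along the filtration of a functor by its parts in degrees
`≥ -k` (`injective_of_ext_eq_zero`). After dimension shifting every functor has injective dimension
`≤ n`, which bounds the global dimension. As all hypotheses used are self-dual, the same holds with
the two sides exchanged, and the global dimensions agree (`globalDimension_op_eq`).
-/

/-! ### The degree-zero part of a graded category -/

namespace GradedLinearCategory

section DegreeZero

variable {K : Type w} [Field K] {C : Type u} [Category.{v} C] [Preadditive C] [Linear K C]
  [GradedLinearCategory K C]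

lemma eq_zero_of_neg (hpos : IsPositivelyGraded K C) {X Y : C} {i : ℤ} (hi : i < 0)
    {f : X ⟶ Y} (hf : f ∈ homDeg (K := K) X Y i) : f = 0 := by
  rw [hpos X Y i hi] at hf
  exact hf

lemma iSup_homDeg (X Y : C) : ⨆ i, homDeg (K := K) X Y i = ⊤ :=
  ((DirectSum.isInternal_submodule_iff_iSupIndep_and_iSup_eq_top _).1 (isInternal X Y)).2

lemma mem_positivePart {X Y : C} {i : ℤ} (hi : 1 ≤ i) {f : X ⟶ Y}
    (hf : f ∈ homDeg (K := K) X Y i) : f ∈ positivePart K X Y :=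
  Submodule.mem_iSup_of_mem (p := fun i : {i : ℤ // 1 ≤ i} => homDeg (K := K) X Y i) ⟨i, hi⟩ hf

lemma eq_zero_of_mem_positivePart {X Y : C} {f : X ⟶ Y} (h₀ : f ∈ homDeg (K := K) X Y 0)
    (h₁ : f ∈ positivePart K X Y) : f = 0 := by
  have h := ((DirectSum.isInternal_submodule_iff_iSupIndep_and_iSup_eq_top _).1
    (isInternal (K := K) X Y)).1 0
  refine (Submodule.disjoint_def.1 h) f h₀ (?_ : f ∈ _)
  refine (iSup_le ?_ : positivePart K X Y ≤ _) h₁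
  rintro ⟨i, hi⟩
  exact le_iSup₂_of_le i (by omega) le_rfl

/-- In a positively graded category every morphism is the sum of a morphism of degree zero and a
morphism with components in positive degrees. -/
lemma exists_degreeZero_part (hpos : IsPositivelyGraded K C) {X Y : C} (f : X ⟶ Y) :
    ∃ g ∈ homDeg (K := K) X Y 0, f - g ∈ positivePart K X Y := by
  have hf : f ∈ ⨆ i, homDeg (K := K) X Y i := by rw [iSup_homDeg]; trivial
  induction hf using Submodule.iSup_induction' with
  | mem i f hf =>
    rcases lt_trichotomy i 0 with hi | rfl | hi
    · rw [eq_zero_of_neg hpos hi hf]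
      exact ⟨0, zero_mem _, by simp⟩
    · exact ⟨f, hf, by simp⟩
    · exact ⟨0, zero_mem _, by simpa using mem_positivePart hi hf⟩
  | zero => exact ⟨0, zero_mem _, by simp⟩
  | add f g _ _ hf hg =>
    obtain ⟨f', hf', hf⟩ := hf
    obtain ⟨g', hg', hg⟩ := hg
    exact ⟨f' + g', add_mem hf' hg', by simpa [add_sub_add_comm] using add_mem hf hg⟩

lemma comp_mem_positivePart_left (hpos : IsPositivelyGraded K C) {X Y Z : C} {f : X ⟶ Y}
    (hf : f ∈ positivePart K X Y) (g : Y ⟶ Z) : f ≫ g ∈ positivePart K X Z := by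
  refine Submodule.iSup_induction _ (motive := fun f => f ≫ g ∈ positivePart K X Z) hf ?_
    (by simp) (fun f₁ f₂ h₁ h₂ => by simpa using add_mem h₁ h₂)
  rintro ⟨i, hi⟩ f (hf : f ∈ homDeg (K := K) X Y i)
  have hg : g ∈ ⨆ j, homDeg (K := K) Y Z j := by rw [iSup_homDeg]; trivial
  refine Submodule.iSup_induction _ (motive := fun g => f ≫ g ∈ positivePart K X Z) hg ?_
    (by simp) (fun g₁ g₂ h₁ h₂ => by simpa using add_mem h₁ h₂)
  intro j g hg
  rcases lt_or_ge j 0 with hj | hj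
  · simp [eq_zero_of_neg hpos hj hg]
  · exact mem_positivePart (by omega) (comp_mem hf hg)

lemma comp_mem_positivePart_right (hpos : IsPositivelyGraded K C) {X Y Z : C} (f : X ⟶ Y)
    {g : Y ⟶ Z} (hg : g ∈ positivePart K Y Z) : f ≫ g ∈ positivePart K X Z := by
  refine Submodule.iSup_induction _ (motive := fun g => f ≫ g ∈ positivePart K X Z) hg ?_
    (by simp) (fun g₁ g₂ h₁ h₂ => by simpa using add_mem h₁ h₂)
  rintro ⟨j, hj⟩ g (hg : g ∈ homDeg (K := K) Y Z j)
  have hf : f ∈ ⨆ i, homDeg (K := K) X Y i := by rw [iSup_homDeg]; trivial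
  refine Submodule.iSup_induction _ (motive := fun f => f ≫ g ∈ positivePart K X Z) hf ?_
    (by simp) (fun f₁ f₂ h₁ h₂ => by simpa using add_mem h₁ h₂)
  intro i f hf
  rcases lt_or_ge i 0 with hi | hi
  · simp [eq_zero_of_neg hpos hi hf]
  · exact mem_positivePart (by omega) (comp_mem hf hg)

/-- Replacing two morphisms by their degree-zero parts changes the composite by a morphism with
components in positive degrees. -/
lemma comp_sub_comp_mem_positivePart (hpos : IsPositivelyGraded K C) {X Y Z : C} {f f' : X ⟶ Y}
    {g g' : Y ⟶ Z} (hf : f - f' ∈ positivePart K X Y) (hg : g - g' ∈ positivePart K Y Z) :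
    f ≫ g - f' ≫ g' ∈ positivePart K X Z := by
  have : f ≫ g - f' ≫ g' = (f - f') ≫ g + f' ≫ (g - g') := by simp
  rw [this]
  exact add_mem (comp_mem_positivePart_left hpos hf g) (comp_mem_positivePart_right hpos f' hg)

/-- A decomposition of an identity can be made homogeneous of degree zero. -/
lemma exists_degreeZero_decomposition (hpos : IsPositivelyGraded K C) {X : C} {T : Type*}
    [Fintype T] {Y : T → C} (p : ∀ a, X ⟶ Y a) (i : ∀ a, Y a ⟶ X) (h : ∑ a, p a ≫ i a = 𝟙 X) :
    ∃ (p' : ∀ a, X ⟶ Y a) (i' : ∀ a, Y a ⟶ X),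
      (∀ a, p' a ∈ homDeg (K := K) X (Y a) 0) ∧ (∀ a, i' a ∈ homDeg (K := K) (Y a) X 0) ∧
        ∑ a, p' a ≫ i' a = 𝟙 X := by
  choose p' hp' hp using fun a => exists_degreeZero_part hpos (p a)
  choose i' hi' hi using fun a => exists_degreeZero_part hpos (i a)
  refine ⟨p', i', hp', hi', ?_⟩
  rw [← sub_eq_zero, ← neg_sub, neg_eq_zero]
  apply eq_zero_of_mem_positivePart (K := K)
  · refine sub_mem (id_mem X) (sum_mem fun a _ => ?_)
    simpa using comp_mem (hp' a) (hi' a)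
  · rw [← h, ← Finset.sum_sub_distrib]
    exact sum_mem fun a _ => comp_sub_comp_mem_positivePart hpos (hp a) (hi a)

variable (K) in
/-- An object `Y` is a division object if every nonzero morphism of degree zero starting in `Y` is
a split monomorphism in degree zero, and every nonzero morphism of degree zero ending in `Y` is a
split epimorphism in degree zero. Zero objects are allowed. -/
def IsDivisionObject (Y : C) : Prop :=
  (∀ ⦃Z : C⦄ ⦃f : Y ⟶ Z⦄, f ∈ homDeg (K := K) Y Z 0 → f ≠ 0 →
    ∃ g ∈ homDeg (K := K) Z Y 0, f ≫ g = 𝟙 Y) ∧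
  (∀ ⦃Z : C⦄ ⦃f : Z ⟶ Y⦄, f ∈ homDeg (K := K) Z Y 0 → f ≠ 0 →
    ∃ g ∈ homDeg (K := K) Y Z 0, g ≫ f = 𝟙 Y)

variable (K C) in
/-- The self-dual condition on a graded category from which everything is deduced: it is positively
graded, its degree-zero part is semisimple (identities factor in degree zero through finitely many
division objects), and a small family of objects suffices up to retracts in degree zero. -/
structure DegreeZeroSemisimple : Prop where
  pos : IsPositivelyGraded K C
  decomp : ∀ X : C, ∃ (n : ℕ) (Y : Fin n → C) (p : ∀ a, X ⟶ Y a) (i : ∀ a, Y a ⟶ X),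
    (∀ a, p a ∈ homDeg (K := K) X (Y a) 0) ∧ (∀ a, i a ∈ homDeg (K := K) (Y a) X 0) ∧
      ∑ a, p a ≫ i a = 𝟙 X ∧ ∀ a, IsDivisionObject K (Y a)
  small : ∃ (T : Type v) (Z : T → C), ∀ X : C, ∃ (t : T) (p : X ⟶ Z t) (i : Z t ⟶ X),
    p ∈ homDeg (K := K) X (Z t) 0 ∧ i ∈ homDeg (K := K) (Z t) X 0 ∧ p ≫ i = 𝟙 X

lemma mem_homDeg_op {X Y : Cᵒᵖ} {i : ℤ} {f : X ⟶ Y} :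
    f ∈ homDeg (K := K) X Y i ↔ f.unop ∈ homDeg (K := K) Y.unop X.unop i :=
  ⟨by rintro ⟨g, hg, rfl⟩; exact hg, fun h => ⟨f.unop, h, rfl⟩⟩

lemma IsDivisionObject.op {Y : C} (h : IsDivisionObject K Y) :
    IsDivisionObject K (Opposite.op Y) := by
  constructor
  · intro Z f hf hf0
    obtain ⟨g, hg, e⟩ := h.2 (mem_homDeg_op.1 hf) (fun h0 => hf0 (Quiver.Hom.unop_inj h0))
    exact ⟨g.op, mem_homDeg_op.2 hg, Quiver.Hom.unop_inj e⟩
  · intro Z f hf hf0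
    obtain ⟨g, hg, e⟩ := h.1 (mem_homDeg_op.1 hf) (fun h0 => hf0 (Quiver.Hom.unop_inj h0))
    exact ⟨g.op, mem_homDeg_op.2 hg, Quiver.Hom.unop_inj e⟩

lemma DegreeZeroSemisimple.op (h : DegreeZeroSemisimple K C) : DegreeZeroSemisimple K Cᵒᵖ where
  pos X Y i hi := by
    rw [eq_bot_iff]
    intro f hf
    exact Quiver.Hom.unop_inj (eq_zero_of_neg h.pos hi (mem_homDeg_op.1 hf))
  decomp X := by
    obtain ⟨n, Y, p, i, hp, hi, e, hY⟩ := h.decomp X.unop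
    refine ⟨n, fun a => Opposite.op (Y a), fun a => (i a).op, fun a => (p a).op,
      fun a => mem_homDeg_op.2 (hi a), fun a => mem_homDeg_op.2 (hp a), ?_, fun a => (hY a).op⟩
    apply Quiver.Hom.unop_inj
    rw [unop_sum]
    exact e
  small := by
    obtain ⟨T, Z, hZ⟩ := h.small
    refine ⟨T, fun t => Opposite.op (Z t), fun X => ?_⟩
    obtain ⟨t, p, i, hp, hi, e⟩ := hZ X.unop
    exact ⟨t, i.op, p.op, mem_homDeg_op.2 hi, mem_homDeg_op.2 hp, Quiver.Hom.unop_inj e⟩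

end DegreeZero

section Local

instance {K R : Type*} [Field K] [Ring R] [Algebra K R] (𝒜 : ℤ → Submodule K R) [GradedRing 𝒜] :
    IsCoatomic (HomogeneousIdeal 𝒜) := by
  apply CompleteLattice.coatomic_of_top_compact
  rw [CompleteLattice.isCompactElement_iff_le_of_directed_sSup_le]
  intro s hs hd h
  have h1 : (1 : R) ∈ (sSup s).toIdeal := by
    rw [top_le_iff.1 h]; trivial
  rw [HomogeneousIdeal.toIdeal_sSup, ← sSup_image, Submodule.mem_sSup_of_directed (hs.image _)
    (directedOn_image.2 hd)] at h1
  obtain ⟨_, ⟨I, hI, rfl⟩, h1⟩ := h1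
  refine ⟨I, hI, top_le_iff.2 ?_⟩
  rw [HomogeneousIdeal.eq_top_iff]
  exact (Ideal.eq_top_iff_one _).2 h1

/-- In a graded local ring, a homogeneous element outside the maximal homogeneous left ideal has a
left inverse. -/
lemma exists_left_inverse {K R : Type*} [Field K] [Ring R] [Algebra K R]
    {𝒜 : ℤ → Submodule K R} [GradedRing 𝒜] (hloc : IsGradedLocal 𝒜) {i : ℤ} {d : R}
    (hd : d ∈ 𝒜 i) (hd' : d ∉ gradedJacobson 𝒜) : ∃ g, g * d = 1 := by
  have hom : (Ideal.span {d}).IsHomogeneous 𝒜 := Ideal.homogeneous_span _ _ (by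
    rintro x rfl
    exact ⟨i, hd⟩)
  obtain ⟨m, hm, huniq⟩ := hloc
  rcases eq_top_or_exists_le_coatom (⟨_, hom⟩ : HomogeneousIdeal 𝒜) with h | ⟨I, hI, h⟩
  · rw [HomogeneousIdeal.eq_top_iff, Ideal.eq_top_iff_one] at h
    exact Ideal.mem_span_singleton'.1 h
  · refine absurd (fun J hJ => ?_) hd'
    rw [huniq J hJ, ← huniq I hI]
    exact h (Ideal.mem_span_singleton_self d)

variable {K : Type w} [Field K] {C : Type u} [Category.{v} C] [Preadditive C] [Linear K C]
  [GradedLinearCategory K C]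

lemma add_mem_gradedJacobson {R : Type*} [Ring R] [Algebra K R]
    {𝒜 : ℤ → Submodule K R} [GradedRing 𝒜] {a b : R} (ha : a ∈ gradedJacobson 𝒜)
    (hb : b ∈ gradedJacobson 𝒜) : a + b ∈ gradedJacobson 𝒜 :=
  fun I hI => add_mem (ha I hI) (hb I hI)

/-- If the radical is the part of positive degree, a nonzero morphism of degree zero starting in an
object with graded local endomorphism ring is a split monomorphism in degree zero. -/
lemma exists_retraction (hpos : IsPositivelyGraded K C)
    (hrad : ∀ X Y : C, gradedRad K X Y = (positivePart K X Y : Set (X ⟶ Y)))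
    {Y Z : C} (hY : IsGradedLocal (endDeg K Y)) {f : Y ⟶ Z} (hf : f ∈ homDeg (K := K) Y Z 0)
    (hf0 : f ≠ 0) : ∃ g ∈ homDeg (K := K) Z Y 0, f ≫ g = 𝟙 Y := by
  have hf' : f ∉ gradedRad K Y Z := by
    rw [hrad]
    exact fun h => hf0 (eq_zero_of_mem_positivePart hf h)
  simp only [gradedRad, Set.mem_ofPred_eq, not_forall] at hf'
  obtain ⟨g, hg⟩ := hf'
  obtain ⟨g₀, hg₀, hgg⟩ := exists_degreeZero_part hpos g
  have hjac : ∀ p ∈ positivePart K Y Y, (p : End Y) ∈ gradedJacobson (endDeg K Y) := by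
    intro p hp
    have : p ∈ gradedRad K Y Y := by rw [hrad]; exact hp
    simpa using this (𝟙 Y)
  have h₀ : f ≫ g₀ ∈ homDeg (K := K) Y Y 0 := by simpa using comp_mem hf hg₀
  have hd : (f ≫ g₀ : End Y) ∉ gradedJacobson (endDeg K Y) := by
    intro h
    apply hg
    rw [show f ≫ g = f ≫ g₀ + f ≫ (g - g₀) by simp]
    exact add_mem_gradedJacobson (R := End Y) h
      (hjac _ (comp_mem_positivePart_right hpos f hgg))
  obtain ⟨e, he⟩ := exists_left_inverse hY h₀ hd
  obtain ⟨e₀, he₀, hee⟩ := exists_degreeZero_part hpos (e : Y ⟶ Y)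
  refine ⟨g₀ ≫ e₀, by simpa using comp_mem hg₀ he₀, ?_⟩
  rw [← sub_eq_zero, ← neg_sub, neg_eq_zero]
  apply eq_zero_of_mem_positivePart (K := K)
  · refine sub_mem (id_mem Y) ?_
    simpa using comp_mem hf (comp_mem hg₀ he₀)
  · have he' : (f ≫ g₀) ≫ (e : Y ⟶ Y) = 𝟙 Y := he
    rw [← he', ← Category.assoc, ← Preadditive.comp_sub]
    exact comp_mem_positivePart_right hpos _ hee

/-- A positively graded Krull-Schmidt category whose radical is its part of positive degree has a
semisimple degree-zero part. -/
lemma degreeZeroSemisimple [HasFiniteBiproducts C] [EssentiallySmall.{v} C]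
    (hpos : IsPositivelyGraded K C) (hKS : IsKrullSchmidt K C)
    (hrad : ∀ X Y : C, gradedRad K X Y = (positivePart K X Y : Set (X ⟶ Y))) :
    DegreeZeroSemisimple K C := by
  have key : ∀ X : C, ∃ (n : ℕ) (Y : Fin n → C) (p : ∀ a, X ⟶ Y a) (i : ∀ a, Y a ⟶ X),
      (∀ a, p a ∈ homDeg (K := K) X (Y a) 0) ∧ (∀ a, i a ∈ homDeg (K := K) (Y a) X 0) ∧
        ∑ a, p a ≫ i a = 𝟙 X ∧ ∀ a, IsGradedLocal (endDeg K (Y a)) := by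
    intro X
    obtain ⟨n, Y, ⟨e⟩, hY⟩ := hKS X
    have hsum : ∑ a, (e.hom ≫ biproduct.π Y a) ≫ (biproduct.ι Y a ≫ e.inv) = 𝟙 X := by
      calc ∑ a, (e.hom ≫ biproduct.π Y a) ≫ (biproduct.ι Y a ≫ e.inv)
          = e.hom ≫ (∑ a, biproduct.π Y a ≫ biproduct.ι Y a) ≫ e.inv := by
            simp only [Preadditive.comp_sum, Preadditive.sum_comp, Category.assoc]
        _ = 𝟙 X := by rw [biproduct.total, Category.id_comp, e.hom_inv_id]
    obtain ⟨p, i, hp, hi, h⟩ := exists_degreeZero_decomposition hpos _ _ hsum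
    exact ⟨n, Y, p, i, hp, hi, h, hY⟩
  have div : ∀ Y : C, IsGradedLocal (endDeg K Y) → IsDivisionObject K Y := by
    intro Y hY
    refine ⟨fun Z f hf hf0 => exists_retraction hpos hrad hY hf hf0, fun Z f hf hf0 => ?_⟩
    obtain ⟨n, W, p, i, hp, hi, h, hW⟩ := key Z
    -- some component `W a ⟶ Z ⟶ Y` of `f` is nonzero
    obtain ⟨a, ha⟩ : ∃ a, i a ≫ f ≠ 0 := by
      by_contra! h0
      apply hf0
      rw [← Category.id_comp f, ← h, Preadditive.sum_comp]
      simp [h0]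
    have hif : i a ≫ f ∈ homDeg (K := K) (W a) Y 0 := by simpa using comp_mem (hi a) hf
    obtain ⟨g, hg, hfg⟩ := exists_retraction hpos hrad (hW a) hif ha
    have hg0 : g ≠ 0 := by
      rintro rfl
      apply ha
      rw [← Category.id_comp (i a ≫ f), ← hfg]
      simp
    -- the retraction `g` is itself split mono, so it is inverse to `i a ≫ f`
    obtain ⟨k, hk, hgk⟩ := exists_retraction hpos hrad hY hg hg0
    have hgif : g ≫ i a ≫ f = 𝟙 Y := by
      have : i a ≫ f = k := by
        rw [← Category.comp_id (i a ≫ f), ← hgk, ← Category.assoc, hfg, Category.id_comp]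
      rw [this, hgk]
    exact ⟨g ≫ i a, by simpa using comp_mem hg (hi a), by simpa using hgif⟩
  refine ⟨hpos, fun X => ?_, SmallModel.{v} C, (equivSmallModel.{v} C).inverse.obj, fun X => ?_⟩
  · obtain ⟨n, Y, p, i, hp, hi, h, hY⟩ := key X
    exact ⟨n, Y, p, i, hp, hi, h, fun a => div _ (hY a)⟩
  · let e := (equivSmallModel.{v} C).unitIso.app X
    obtain ⟨p, i, hp, hi, h⟩ := exists_degreeZero_decomposition (K := K) (T := Unit) hpos
      (fun _ => e.hom) (fun _ => e.inv) (by simp)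
    exact ⟨_, p (), i (), hp (), hi (), by simpa using h⟩

end Local

end GradedLinearCategory

/-! ### Subfunctors, quotients and pointwise exactness -/

namespace GrFunctor

section Basic

variable {K : Type w} [Field K] {C : Type u} [Category.{v} C] [Preadditive C] [Linear K C]
  [GradedLinearCategory K C]

lemma map_map (F : GrFunctor K C) {X Y Z : C} {i j k l m n : ℤ} (hl : j + k = l) (hm : i + l = m)
    (hm' : n + k = m) {f : homDeg (K := K) X Y i} {g : homDeg (K := K) Y Z j}
    {e : homDeg (K := K) X Z n} (hn : i + j = n) (he : f.1 ≫ g.1 = e.1) (x : F.obj Z k) :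
    F.map hm f (F.map hl g x) = F.map hm' e x := by
  subst hn
  obtain ⟨e, he'⟩ := e
  dsimp only at he
  subst he
  exact (F.map_comp hl hm hm' f g x).symm

lemma map_map_congr (F : GrFunctor K C) {X Y Y' Z : C} {i j k l m i' j' l' : ℤ} (hl : j + k = l)
    (hm : i + l = m) (hl' : j' + k = l') (hm' : i' + l' = m) {f : homDeg (K := K) X Y i}
    {g : homDeg (K := K) Y Z j} {f' : homDeg (K := K) X Y' i'} {g' : homDeg (K := K) Y' Z j'}
    (he : f.1 ≫ g.1 = f'.1 ≫ g'.1) (x : F.obj Z k) :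
    F.map hm f (F.map hl g x) = F.map hm' f' (F.map hl' g' x) :=
  (F.map_map hl hm (show i + j + k = m by omega) rfl (e := ⟨f.1 ≫ g.1, comp_mem f.2 g.2⟩)
    rfl x).trans (F.map_map hl' hm' _ (by omega) he.symm x).symm

lemma map_eq_self (F : GrFunctor K C) {X : C} {j : ℤ} (h : 0 + j = j) {e : homDeg (K := K) X X 0}
    (he : e.1 = 𝟙 X) (x : F.obj X j) : F.map h e x = x := by
  obtain ⟨e, he'⟩ := e
  subst he
  exact F.map_id X j x

lemma mono_of_injective {F G : GrFunctor K C} (η : F ⟶ G)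
    (h : ∀ X i, Function.Injective (η.app X i)) : Mono η :=
  ⟨fun θ ζ e => by
    ext X i x
    exact h X i (congrArg (fun ξ : _ ⟶ G => ξ.app X i x) e)⟩

lemma epi_of_surjective {F G : GrFunctor K C} (η : F ⟶ G)
    (h : ∀ X i, Function.Surjective (η.app X i)) : Epi η :=
  ⟨fun θ ζ e => by
    ext X i x
    obtain ⟨y, rfl⟩ := h X i x
    exact congrArg (fun ξ : F ⟶ _ => ξ.app X i y) e⟩

lemma shortExact_mk {A B D : GrFunctor K C} (η : A ⟶ B) (θ : B ⟶ D) (h : η ≫ θ = 0)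
    (inj : ∀ X i, Function.Injective (η.app X i))
    (surj : ∀ X i, Function.Surjective (θ.app X i))
    (ex : ∀ X i x, θ.app X i x = 0 → x ∈ LinearMap.range (η.app X i)) :
    (ShortComplex.mk η θ h).ShortExact where
  exact := ShortComplex.exact_of_f_is_kernel _ (isLimitOfExact η θ h inj ex)
  mono_f := mono_of_injective η inj
  epi_g := epi_of_surjective θ surj

lemma shortExact_coker {A B : GrFunctor K C} (η : A ⟶ B)
    (inj : ∀ X i, Function.Injective (η.app X i)) :
    (ShortComplex.mk η (cokerπ η) (comp_cokerπ η)).ShortExact :=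
  shortExact_mk _ _ _ inj (fun _ _ => Submodule.mkQ_surjective _)
    fun _ _ _ hx => (Submodule.Quotient.mk_eq_zero _).1 hx

lemma shortExact_ker {A B : GrFunctor K C} (η : A ⟶ B)
    (surj : ∀ X i, Function.Surjective (η.app X i)) :
    (ShortComplex.mk (kerι η) η (kerι_comp η)).ShortExact :=
  shortExact_mk _ _ _ (fun _ _ => Subtype.val_injective) surj fun _ _ x hx => ⟨⟨x, hx⟩, rfl⟩

lemma mem_range_of_shortExact {S : ShortComplex (GrFunctor K C)} (hS : S.ShortExact) {X : C}
    {i : ℤ} {x : S.X₂.obj X i} (hx : S.g.app X i x = 0) : x ∈ LinearMap.range (S.f.app X i) := by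
  have := hS.mono_f
  exact ⟨(hS.exact.lift (kerι S.g) (kerι_comp S.g)).app X i ⟨x, hx⟩,
    congrArg (fun ζ : ker S.g ⟶ _ => ζ.app X i ⟨x, hx⟩)
      (hS.exact.lift_f (kerι S.g) (kerι_comp S.g))⟩

/-- A subfunctor of a graded functor: graded subspaces stable under all homogeneous morphisms. -/
structure Subfunctor (F : GrFunctor K C) where
  carrier : ∀ (X : C) (i : ℤ), Submodule K (F.obj X i)
  map_mem : ∀ {X Y : C} {i j k : ℤ} (h : i + j = k) (f : homDeg (K := K) X Y i) {x : F.obj Y j},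
    x ∈ carrier Y j → F.map h f x ∈ carrier X k

namespace Subfunctor

variable {F : GrFunctor K C}

/-- A subfunctor as a graded functor. -/
def toFunctor (N : Subfunctor F) : GrFunctor K C where
  obj X i := ModuleCat.of K (N.carrier X i)
  map h :=
    { toFun := fun f => (F.map h f).restrict fun _ hx => N.map_mem h f hx
      map_add' := fun f g => LinearMap.ext fun x => Subtype.ext (by simp)
      map_smul' := fun r f => LinearMap.ext fun x => Subtype.ext (by simp) }
  map_id X j x := Subtype.ext (F.map_id X j x.1)
  map_comp hl hm hm' f g x := Subtype.ext (F.map_comp hl hm hm' f g x.1)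

/-- The inclusion of a subfunctor. -/
def ι (N : Subfunctor F) : N.toFunctor ⟶ F :=
  ⟨fun X i => (N.carrier X i).subtype, fun _ _ _ => rfl⟩

/-- Factorization through a subfunctor. -/
def lift (N : Subfunctor F) {G : GrFunctor K C} (η : G ⟶ F)
    (h : ∀ X i x, η.app X i x ∈ N.carrier X i) : G ⟶ N.toFunctor :=
  ⟨fun X i => (η.app X i).codRestrict _ (h X i), fun hk f x => Subtype.ext (η.naturality hk f x)⟩

/-- The quotient of a graded functor by a subfunctor. -/
def quotient (N : Subfunctor F) : GrFunctor K C where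
  obj X i := ModuleCat.of K (F.obj X i ⧸ N.carrier X i)
  map {X Y i j k} h :=
    { toFun := fun f => Submodule.mapQ _ _ (F.map h f) fun _ hx => N.map_mem h f hx
      map_add' := fun f g => by
        apply Submodule.linearMap_qext; ext x; simp
      map_smul' := fun r f => by
        apply Submodule.linearMap_qext; ext x; simp }
  map_id X j x := by
    obtain ⟨x, rfl⟩ := Submodule.mkQ_surjective _ x
    exact congrArg _ (F.map_id X j x)
  map_comp hl hm hm' f g x := by
    obtain ⟨x, rfl⟩ := Submodule.mkQ_surjective _ x
    exact congrArg _ (F.map_comp hl hm hm' f g x)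

/-- The projection onto the quotient by a subfunctor. -/
def π (N : Subfunctor F) : F ⟶ N.quotient :=
  ⟨fun X i => (N.carrier X i).mkQ, fun _ _ _ => rfl⟩

lemma π_surjective (N : Subfunctor F) (X : C) (i : ℤ) : Function.Surjective (N.π.app X i) :=
  Submodule.mkQ_surjective _

lemma π_eq_zero_iff (N : Subfunctor F) {X : C} {i : ℤ} {x : F.obj X i} :
    N.π.app X i x = 0 ↔ x ∈ N.carrier X i :=
  Submodule.Quotient.mk_eq_zero _

/-- Morphisms out of a quotient. -/
def desc (N : Subfunctor F) {G : GrFunctor K C} (η : F ⟶ G)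
    (h : ∀ X i, ∀ x ∈ N.carrier X i, η.app X i x = 0) : N.quotient ⟶ G :=
  ⟨fun X i => (N.carrier X i).liftQ (η.app X i) (h X i), fun hk f x => by
    obtain ⟨x, rfl⟩ := Submodule.mkQ_surjective _ x
    exact η.naturality hk f x⟩

end Subfunctor

/-- A graded functor is bounded below if it vanishes in all sufficiently small degrees, uniformly
in the object. -/
def IsBoundedBelow (F : GrFunctor K C) : Prop :=
  ∃ m : ℤ, ∀ (X : C) (i : ℤ), i < m → ∀ x : F.obj X i, x = 0

/-- A graded functor is annihilated by positive degrees if all morphisms of positive degree act as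
zero. Under the standing hypotheses these are the semisimple functors. -/
def IsAnnihilated (F : GrFunctor K C) : Prop :=
  ∀ ⦃X Y : C⦄ ⦃i j k : ℤ⦄ (h : i + j = k) (f : homDeg (K := K) X Y i) (x : F.obj Y j),
    0 < i → F.map h f x = 0

end Basic

/-! ### Representable functors, direct sums and enough projectives -/

section Projective

variable {K : Type w} [Field K] {C : Type u} [Category.{v} C] [Preadditive C] [Linear K C]
  [GradedLinearCategory K C]

/-- The representable functor `Hom(-, Z)`, shifted so that `𝟙 Z` has degree `d`. -/
def repr (Z : C) (d : ℤ) : GrFunctor K C where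
  obj X i := ModuleCat.of K (homDeg (K := K) X Z (i - d))
  map {X Y i j k} h := LinearMap.mk₂ K
    (fun (f : homDeg (K := K) X Y i) (g : homDeg (K := K) Y Z (j - d)) =>
      (⟨f.1 ≫ g.1, by
        have := comp_mem f.2 g.2
        rwa [show i + (j - d) = k - d by omega] at this⟩ : homDeg (K := K) X Z (k - d)))
    (fun _ _ _ => Subtype.ext (by simp)) (fun _ _ _ => Subtype.ext (by simp))
    (fun _ _ _ => Subtype.ext (by simp)) (fun _ _ _ => Subtype.ext (by simp))
  map_id X j x := Subtype.ext (Category.id_comp x.1)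
  map_comp hl hm hm' f g x := Subtype.ext (Category.assoc f.1 g.1 x.1)

/-- The morphism from a representable functor given by an element, as in Yoneda's lemma. -/
def reprDesc (F : GrFunctor K C) {Z : C} {d : ℤ} (x : F.obj Z d) : repr (K := K) Z d ⟶ F where
  app X i := (F.map (sub_add_cancel i d)).flip x
  naturality {X Y i j k} h f g := by
    exact (F.map_map (sub_add_cancel j d) h (sub_add_cancel k d) (by omega) rfl x).symm

/-- The generator of a representable functor. -/
def reprGen (Z : C) (d : ℤ) : (repr (K := K) Z d).obj Z d :=
  (⟨𝟙 Z, by rw [sub_self]; exact id_mem Z⟩ : homDeg (K := K) Z Z (d - d))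

lemma reprDesc_gen (F : GrFunctor K C) {Z : C} {d : ℤ} (x : F.obj Z d) :
    (reprDesc F x).app Z d (reprGen Z d) = x := by
  have : ∀ (e : ℤ) (h : e + d = d) (he : 𝟙 Z ∈ homDeg (K := K) Z Z e),
      F.map h ⟨𝟙 Z, he⟩ x = x := by
    intro e h he
    obtain rfl : e = 0 := by omega
    exact F.map_id Z d x
  exact this _ _ _

lemma repr_hom_ext {F : GrFunctor K C} {Z : C} {d : ℤ} {η θ : repr (K := K) Z d ⟶ F}
    (h : η.app Z d (reprGen Z d) = θ.app Z d (reprGen Z d)) : η = θ := by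
  ext X i g
  have hg : (repr (K := K) Z d).map (sub_add_cancel i d) g (reprGen Z d) = g :=
    Subtype.ext (Category.comp_id g.1)
  have h₁ := η.naturality (sub_add_cancel i d) g (reprGen Z d)
  have h₂ := θ.naturality (sub_add_cancel i d) g (reprGen Z d)
  rw [hg] at h₁ h₂
  rw [h₁, h₂, h]

instance projective_repr (Z : C) (d : ℤ) : Projective (repr (K := K) Z d) where
  factors {E F} f e _ := by
    obtain ⟨x, hx⟩ := app_surjective_of_epi e Z d (f.app Z d (reprGen Z d))
    refine ⟨reprDesc E x, repr_hom_ext ?_⟩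
    rw [comp_app, LinearMap.comp_apply, reprDesc_gen, hx]

variable {T : Type v} (G : T → GrFunctor K C)

/-- The direct sum of a small family of graded functors, computed pointwise. -/
def directSum : GrFunctor K C where
  obj X i := ModuleCat.of K (Π₀ t, (G t).obj X i)
  map h :=
    { toFun := fun f => DFinsupp.mapRange.linearMap fun t => (G t).map h f
      map_add' := fun f g => LinearMap.ext fun x => DFinsupp.ext fun t => by simp
      map_smul' := fun r f => LinearMap.ext fun x => DFinsupp.ext fun t => by simp }
  map_id X j x := DFinsupp.ext fun t => (G t).map_id X j _
  map_comp hl hm hm' f g x := DFinsupp.ext fun t => (G t).map_comp hl hm hm' f g _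

open Classical in
/-- The morphism from a direct sum given by a family of morphisms. -/
noncomputable def directSumDesc {F : GrFunctor K C} (η : ∀ t, G t ⟶ F) : directSum G ⟶ F where
  app X i := DFinsupp.lsum ℕ fun t => (η t).app X i
  naturality {X Y i j k} h f x := by
    refine LinearMap.congr_fun (f := (DFinsupp.lsum ℕ fun t => (η t).app X k).comp
      (DFinsupp.mapRange.linearMap fun t => (G t).map h f))
      (g := (F.map h f).comp (DFinsupp.lsum ℕ fun t => (η t).app Y j))
      (DFinsupp.lhom_ext fun t y => ?_) x
    simpa using (η t).naturality h f y

open Classical in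
/-- The inclusion of a summand. -/
noncomputable def directSumι (t : T) : G t ⟶ directSum G where
  app X i := DFinsupp.lsingle (R := K) (M := fun t => (G t).obj X i) t
  naturality h f x := by
    exact (DFinsupp.mapRange_single (f := fun t => (G t).map h f)
      (hf := fun _ => map_zero _)).symm

/-- The direct sum of a family of morphisms. -/
def directSumMap {G G' : T → GrFunctor K C} (η : ∀ t, G t ⟶ G' t) :
    directSum G ⟶ directSum G' where
  app X i := DFinsupp.mapRange.linearMap fun t => (η t).app X i
  naturality h f _ := DFinsupp.ext fun t => (η t).naturality h f _

open Classical in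
lemma directSumι_desc {F : GrFunctor K C} (η : ∀ t, G t ⟶ F) (t : T) :
    directSumι G t ≫ directSumDesc G η = η t := by
  ext X i x
  exact DFinsupp.lsum_single ℕ (fun t => (η t).app X i) t x

lemma directSumDesc_app_ι {F : GrFunctor K C} (η : ∀ t, G t ⟶ F) (t : T) {X : C} {i : ℤ}
    (x : (G t).obj X i) :
    (directSumDesc G η).app X i ((directSumι G t).app X i x) = (η t).app X i x :=
  congrArg (fun ζ : G t ⟶ F => ζ.app X i x) (directSumι_desc G η t)

open Classical in
lemma directSum_hom_ext {F : GrFunctor K C} {η θ : directSum G ⟶ F}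
    (h : ∀ t, directSumι G t ≫ η = directSumι G t ≫ θ) : η = θ := by
  ext X i x
  refine LinearMap.congr_fun (DFinsupp.lhom_ext fun t y => ?_) x
  exact congrArg (fun ζ : _ ⟶ F => ζ.app X i y) (h t)

instance projective_directSum [∀ t, Projective (G t)] : Projective (directSum G) where
  factors {E F} f e _ := by
    refine ⟨directSumDesc G fun t => Projective.factorThru (directSumι G t ≫ f) e, ?_⟩
    apply directSum_hom_ext
    intro t
    rw [← Category.assoc, directSumι_desc, Projective.factorThru_comp]

/-- Direct sums of graded functors are exact. -/
lemma shortExact_directSum {A B D : T → GrFunctor K C} {η : ∀ t, A t ⟶ B t} {θ : ∀ t, B t ⟶ D t}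
    {w : ∀ t, η t ≫ θ t = 0} (h : ∀ t, (ShortComplex.mk (η t) (θ t) (w t)).ShortExact) :
    ∃ w', (ShortComplex.mk (directSumMap η) (directSumMap θ) w').ShortExact := by
  have w' : directSumMap η ≫ directSumMap θ = 0 := by
    ext X i x
    refine DFinsupp.ext fun t => ?_
    exact congrArg (fun ζ : A t ⟶ D t => ζ.app X i ((show Π₀ t, (A t).obj X i from x) t)) (w t)
  refine ⟨w', shortExact_mk _ _ _ (fun X i => ?_) (fun X i => ?_) fun X i x hx => ?_⟩
  · refine (DFinsupp.mapRange_injective (fun t => (η t).app X i) fun _ => map_zero _).2 fun t => ?_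
    have := (h t).mono_f
    exact app_injective_of_mono (η t) X i
  · refine (DFinsupp.mapRange_surjective (fun t => (θ t).app X i) fun _ => map_zero _).2
      fun t => ?_
    have := (h t).epi_g
    exact app_surjective_of_epi (θ t) X i
  · have hr := DFinsupp.range_mapRangeLinearMap fun t => (η t).app X i
    refine (SetLike.ext_iff.1 hr x).2 fun t _ => ?_
    exact mem_range_of_shortExact (h t) (DFunLike.congr_fun (F := Π₀ t, (D t).obj X i) hx t)

/-- The index type of a free functor mapping onto `F`: the nonzero homogeneous elements of `F` at
the objects of a given family. -/
abbrev CoverIndex {T : Type v} (Z : T → C) (F : GrFunctor K C) : Type v :=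
  Σ (t : T) (i : ℤ), {x : F.obj (Z t) i // x ≠ 0}

/-- Every graded functor is a quotient of a projective one, and boundedness below is kept. -/
lemma exists_epi_from_projective (hC : DegreeZeroSemisimple K C) (F : GrFunctor K C) :
    ∃ (P : GrFunctor K C) (p : P ⟶ F), Projective P ∧
      (∀ X i, Function.Surjective (p.app X i)) ∧
      ∀ m : ℤ, (∀ (X : C) (i : ℤ), i < m → ∀ x : F.obj X i, x = 0) →
        ∀ (X : C) (i : ℤ), i < m → ∀ x : P.obj X i, x = 0 := by
  obtain ⟨T, Z, hZ⟩ := hC.small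
  -- only nonzero elements are used as generators, so no generator lies below the bound of `F`
  let G : CoverIndex Z F → GrFunctor K C := fun s => repr (Z s.1) s.2.1
  let η : ∀ s, G s ⟶ F := fun s => reprDesc F s.2.2.1
  refine ⟨directSum G, directSumDesc G η, inferInstance, fun X i x => ?_, fun m hm X i hi x => ?_⟩
  · obtain ⟨t, p, r, hp, hr, e⟩ := hZ X
    have hx : F.map (zero_add i) ⟨p, hp⟩ (F.map (zero_add i) ⟨r, hr⟩ x) = x := by
      rw [F.map_map _ _ (zero_add i) (add_zero 0) (e := ⟨𝟙 X, id_mem X⟩) e, F.map_id]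
    by_cases h0 : F.map (zero_add i) ⟨r, hr⟩ x = 0
    · rw [h0, map_zero] at hx
      exact ⟨0, by rw [map_zero, hx]⟩
    · let s : CoverIndex Z F := ⟨t, i, _, h0⟩
      have hs : (η s).app (Z t) i (reprGen (Z t) i) = F.map (zero_add i) ⟨r, hr⟩ x :=
        reprDesc_gen F _
      refine ⟨(directSum G).map (zero_add i) ⟨p, hp⟩
        ((directSumι G s).app (Z t) i (reprGen (Z t) i)), ?_⟩
      rw [(directSumDesc G η).naturality, directSumDesc_app_ι, hs, hx]
  · refine DFinsupp.ext fun s => Subtype.ext ?_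
    refine eq_zero_of_neg (K := K) hC.pos (i := i - s.2.1) ?_
      ((show Π₀ s, (G s).obj X i from x) s).2
    by_contra h
    exact s.2.2.2 (hm _ _ (by omega) _)

/-- A direct sum of graded functors of projective dimension at most `n` has projective dimension at
most `n`. -/
lemma hasProjectiveDimensionLE_directSum (hC : DegreeZeroSemisimple K C) (n : ℕ)
    (hG : ∀ t, HasProjectiveDimensionLE (G t) n) : HasProjectiveDimensionLE (directSum G) n := by
  induction n generalizing G with
  | zero =>
    have : ∀ t, Projective (G t) := fun t =>
      (projective_iff_hasProjectiveDimensionLE_zero _).2 (hG t)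
    exact (projective_iff_hasProjectiveDimensionLE_zero _).1 inferInstance
  | succ n ih =>
    choose P p hP hp _ using fun t => exists_epi_from_projective hC (G t)
    have ex := fun t => shortExact_ker (p t) (hp t)
    obtain ⟨w, h⟩ := shortExact_directSum ex
    refine (h.hasProjectiveDimensionLT_X₃_iff n (inferInstanceAs (Projective (directSum P)))).2 ?_
    exact ih _ fun t => ((ex t).hasProjectiveDimensionLT_X₃_iff n (hP t)).1 (hG t)

end Projective

end GrFunctor

/-! ### Vector space duality between left and right functors -/

/-- A contravariant functor between graded categories that preserves degrees, given on homogeneous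
morphisms. -/
structure GradedContraFunctor (K : Type w) [Field K] (C C' : Type u) [Category.{v} C]
    [Category.{v} C'] [Preadditive C] [Preadditive C'] [Linear K C] [Linear K C']
    [GradedLinearCategory K C] [GradedLinearCategory K C'] where
  obj : C → C'
  map : ∀ {X Y : C} {i : ℤ}, homDeg (K := K) X Y i →ₗ[K] homDeg (K := K) (obj Y) (obj X) i
  map_id : ∀ X : C, (map (⟨𝟙 X, id_mem X⟩ : homDeg (K := K) X X 0)).1 = 𝟙 (obj X)
  map_comp : ∀ {X Y Z : C} {i j k : ℤ} (f : homDeg (K := K) X Y i) (g : homDeg (K := K) Y Z j)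
    (e : homDeg (K := K) X Z k), f.1 ≫ g.1 = e.1 → (map g).1 ≫ (map f).1 = (map e).1

/-- A pair of contravariant degree-preserving functors between graded categories, adjoint through
natural split epimorphisms `bwd (fwd X) ⟶ X` and `fwd (bwd X) ⟶ X` of degree zero. The case of
interest is that of a category and its opposite; a symmetric formulation makes every statement
about left functors available for right functors without passing to the double opposite. -/
structure GradedDuality (K : Type w) [Field K] (C C' : Type u) [Category.{v} C]
    [Category.{v} C'] [Preadditive C] [Preadditive C'] [Linear K C] [Linear K C']
    [GradedLinearCategory K C] [GradedLinearCategory K C'] where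
  fwd : GradedContraFunctor K C C'
  bwd : GradedContraFunctor K C' C
  unit : ∀ X : C, homDeg (K := K) (bwd.obj (fwd.obj X)) X 0
  counit : ∀ X : C', homDeg (K := K) (fwd.obj (bwd.obj X)) X 0
  unit_naturality : ∀ {X Y : C} {i : ℤ} (f : homDeg (K := K) X Y i),
    (bwd.map (fwd.map f)).1 ≫ (unit Y).1 = (unit X).1 ≫ f.1
  counit_naturality : ∀ {X Y : C'} {i : ℤ} (f : homDeg (K := K) X Y i),
    (fwd.map (bwd.map f)).1 ≫ (counit Y).1 = (counit X).1 ≫ f.1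
  fwd_triangle : ∀ X : C, (fwd.map (unit X)).1 ≫ (counit (fwd.obj X)).1 = 𝟙 (fwd.obj X)
  bwd_triangle : ∀ X : C', (bwd.map (counit X)).1 ≫ (unit (bwd.obj X)).1 = 𝟙 (bwd.obj X)
  unit_split : ∀ X : C, ∃ s : homDeg (K := K) X (bwd.obj (fwd.obj X)) 0, s.1 ≫ (unit X).1 = 𝟙 X
  counit_split : ∀ X : C', ∃ s : homDeg (K := K) X (fwd.obj (bwd.obj X)) 0,
    s.1 ≫ (counit X).1 = 𝟙 X

section

variable {K : Type w} [Field K] {C C' : Type u} [Category.{v} C] [Category.{v} C']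
  [Preadditive C] [Preadditive C'] [Linear K C] [Linear K C']
  [GradedLinearCategory K C] [GradedLinearCategory K C']

/-- The two sides of a duality exchanged. -/
def GradedDuality.symm (d : GradedDuality K C C') : GradedDuality K C' C where
  fwd := d.bwd
  bwd := d.fwd
  unit := d.counit
  counit := d.unit
  unit_naturality := d.counit_naturality
  counit_naturality := d.unit_naturality
  fwd_triangle := d.bwd_triangle
  bwd_triangle := d.fwd_triangle
  unit_split := d.counit_split
  counit_split := d.unit_split

variable (K C) in
/-- The duality between a graded category and its opposite. -/
def GradedDuality.opposite : GradedDuality K C Cᵒᵖ where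
  fwd :=
    { obj := Opposite.op
      map := fun {X Y i} =>
        { toFun := fun f => ⟨f.1.op, mem_homDeg_op.2 f.2⟩
          map_add' := fun _ _ => rfl
          map_smul' := fun _ _ => rfl }
      map_id := fun _ => rfl
      map_comp := fun f g e h => by
        exact congrArg Quiver.Hom.op h }
  bwd :=
    { obj := Opposite.unop
      map := fun {X Y i} =>
        { toFun := fun f => ⟨f.1.unop, mem_homDeg_op.1 f.2⟩
          map_add' := fun _ _ => rfl
          map_smul' := fun _ _ => rfl }
      map_id := fun _ => rfl
      map_comp := fun f g e h => by
        exact congrArg Quiver.Hom.unop h }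
  unit X := ⟨𝟙 X, id_mem X⟩
  counit X := ⟨𝟙 X, id_mem X⟩
  unit_naturality f := (Category.comp_id f.1).trans (Category.id_comp f.1).symm
  counit_naturality f := (Category.comp_id f.1).trans (Category.id_comp f.1).symm
  fwd_triangle X := Category.comp_id (𝟙 (Opposite.op X))
  bwd_triangle X := Category.comp_id (𝟙 (Opposite.unop X))
  unit_split X := ⟨⟨𝟙 X, id_mem X⟩, Category.comp_id _⟩
  counit_split X := ⟨⟨𝟙 X, id_mem X⟩, Category.comp_id _⟩

namespace GrFunctor

variable (E : Type v) [AddCommGroup E] [Module K E]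

/-- The dual of a graded functor with values in a fixed vector space `E`, with
`(D S)(X)_i = Hom_K(S(X)_{-i}, E)`. A general nonzero `E` is used in place of `K` because `K` need
not live in the universe of the values. -/
def dual (τ : GradedContraFunctor K C C') (S : GrFunctor K C') : GrFunctor K C where
  obj X i := ModuleCat.of K (S.obj (τ.obj X) (-i) →ₗ[K] E)
  map {X Y i j k} h :=
    { toFun := fun f => LinearMap.lcomp K E (S.map (show i + -k = -j by omega) (τ.map f))
      map_add' := fun f g => LinearMap.ext fun l => LinearMap.ext fun x => by simp
      map_smul' := fun r f => LinearMap.ext fun l => LinearMap.ext fun x => by simp }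
  map_id X j l := LinearMap.ext fun x => by
    exact congrArg l (S.map_eq_self _ (τ.map_id X) x)
  map_comp {X Y Z i j k l m} hl hm hm' f g x := LinearMap.ext fun y => by
    exact congrArg x (S.map_map _ _ _ (add_comm j i) (τ.map_comp f g _ rfl) y).symm

/-- The dual of a morphism of graded functors. -/
def dualMap (τ : GradedContraFunctor K C C') {S S' : GrFunctor K C'} (η : S ⟶ S') :
    dual E τ S' ⟶ dual E τ S where
  app X i := LinearMap.lcomp K E (η.app (τ.obj X) (-i))
  naturality {X Y i j k} h f l := LinearMap.ext fun x => by
    exact congrArg (show S'.obj (τ.obj Y) (-j) →ₗ[K] E from l)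
      (η.naturality (show i + -k = -j by omega) (τ.map f) x).symm

lemma dualMap_comp (τ : GradedContraFunctor K C C') {S S' S'' : GrFunctor K C'} (η : S ⟶ S')
    (θ : S' ⟶ S'') : dualMap E τ (η ≫ θ) = dualMap E τ θ ≫ dualMap E τ η := rfl

lemma dualMap_surjective (τ : GradedContraFunctor K C C') {S S' : GrFunctor K C'} (η : S ⟶ S')
    (h : ∀ X i, Function.Injective (η.app X i)) (X : C) (i : ℤ) :
    Function.Surjective ((dualMap E τ η).app X i) := by
  intro l
  obtain ⟨r, hr⟩ := (η.app (τ.obj X) (-i)).exists_leftInverse_of_injective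
    (LinearMap.ker_eq_bot.2 (h _ _))
  refine ⟨(show S.obj (τ.obj X) (-i) →ₗ[K] E from l).comp r, LinearMap.ext fun x => ?_⟩
  exact congrArg (show S.obj (τ.obj X) (-i) →ₗ[K] E from l) (LinearMap.congr_fun hr x)

lemma dualMap_injective (τ : GradedContraFunctor K C C') {S S' : GrFunctor K C'} (η : S ⟶ S')
    (h : ∀ X i, Function.Surjective (η.app X i)) (X : C) (i : ℤ) :
    Function.Injective ((dualMap E τ η).app X i) := by
  intro l l' hl
  refine LinearMap.ext fun x => ?_
  obtain ⟨y, rfl⟩ := h _ _ x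
  exact LinearMap.congr_fun hl y

lemma shortExact_dual (τ : GradedContraFunctor K C C') {S : ShortComplex (GrFunctor K C')}
    (hS : S.ShortExact) :
    ∃ w, (ShortComplex.mk (dualMap E τ S.g) (dualMap E τ S.f) w).ShortExact := by
  have := hS.mono_f
  have := hS.epi_g
  have w : dualMap E τ S.g ≫ dualMap E τ S.f = 0 := by
    rw [← dualMap_comp, S.zero]
    ext X i l
    refine LinearMap.ext fun x => ?_
    exact map_zero (show S.X₃.obj (τ.obj X) (-i) →ₗ[K] E from l)
  refine ⟨w, shortExact_mk _ _ w (dualMap_injective E τ _ (app_surjective_of_epi S.g))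
    (dualMap_surjective E τ _ (app_injective_of_mono S.f)) fun X i l hl => ?_⟩
  obtain ⟨s, hs⟩ := (S.g.app (τ.obj X) (-i)).exists_rightInverse_of_surjective
    (LinearMap.range_eq_top.2 (app_surjective_of_epi S.g _ _))
  refine ⟨(show S.X₂.obj (τ.obj X) (-i) →ₗ[K] E from l).comp s, LinearMap.ext fun x => ?_⟩
  have h0 : S.g.app (τ.obj X) (-i) (s (S.g.app (τ.obj X) (-i) x) - x) = 0 := by
    rw [map_sub, sub_eq_zero]
    exact LinearMap.congr_fun hs _
  obtain ⟨y, hy⟩ := mem_range_of_shortExact hS h0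
  have hly : (show S.X₂.obj (τ.obj X) (-i) →ₗ[K] E from l) (S.f.app (τ.obj X) (-i) y) = 0 :=
    LinearMap.congr_fun hl y
  rw [hy, map_sub, sub_eq_zero] at hly
  exact hly

variable (d : GradedDuality K C C')

/-- The evaluation morphism into the double dual. The unit of the duality, acting in degree zero,
also serves to identify the degrees `i` and `-(-i)`. -/
def eval (F : GrFunctor K C) : F ⟶ dual E d.fwd (dual E d.bwd F) where
  app X i := LinearMap.flip
    (LinearMap.id (R := K) (M := F.obj (d.bwd.obj (d.fwd.obj X)) (- -i) →ₗ[K] E)) ∘ₗ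
      F.map (show 0 + i = - -i by omega) (d.unit X)
  naturality {X Y i j k} h f x := LinearMap.ext fun l => by
    exact congrArg (show F.obj (d.bwd.obj (d.fwd.obj X)) (- -k) →ₗ[K] E from l)
      (F.map_map_congr h _ _ (show i + - -j = - -k by omega) (d.unit_naturality f).symm x)

lemma eval_naturality {F G : GrFunctor K C} (η : F ⟶ G) :
    eval E d F ≫ dualMap E d.fwd (dualMap E d.bwd η) = η ≫ eval E d G := by
  ext X i x
  refine LinearMap.ext fun l => ?_
  exact congrArg (show G.obj (d.bwd.obj (d.fwd.obj X)) (- -i) →ₗ[K] E from l)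
    (η.naturality _ (d.unit X) x)

/-- The triangle identity for the adjunction of the two duals. -/
lemma eval_triangle (S : GrFunctor K C') :
    eval E d (dual E d.fwd S) ≫ dualMap E d.fwd (eval E d.symm S) = 𝟙 (dual E d.fwd S) := by
  ext X i l
  refine LinearMap.ext fun x => ?_
  refine congrArg (show S.obj (d.fwd.obj X) (-i) →ₗ[K] E from l) ?_
  exact (S.map_map _ _ (zero_add (-i)) (add_zero 0) (e := ⟨𝟙 _, id_mem _⟩)
    (d.fwd_triangle X) x).trans (S.map_id _ _ x)

lemma eval_injective [Nontrivial E] (F : GrFunctor K C) (X : C) (i : ℤ) :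
    Function.Injective ((eval E d F).app X i) := by
  rw [injective_iff_map_eq_zero]
  intro x hx
  obtain ⟨s, hs⟩ := d.unit_split X
  have hsx : F.map (show 0 + - -i = i by omega) s (F.map (show 0 + i = - -i by omega)
      (d.unit X) x) = x :=
    (F.map_map _ _ (zero_add i) (add_zero 0) (e := ⟨𝟙 _, id_mem _⟩) hs x).trans (F.map_id _ _ x)
  suffices h0 : F.map (show 0 + i = - -i by omega) (d.unit X) x = 0 by
    rw [← hsx, h0, map_zero]
  -- linear maps to a nonzero vector space separate points
  by_contra hne
  obtain ⟨e, he⟩ := exists_ne (0 : E)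
  obtain ⟨φ, hφ⟩ : ∃ φ : Module.Dual K (F.obj (d.bwd.obj (d.fwd.obj X)) (- -i)),
      φ (F.map (show 0 + i = - -i by omega) (d.unit X) x) ≠ 0 := by
    by_contra! h
    exact hne ((Module.forall_dual_apply_eq_zero_iff K _).1 h)
  have := LinearMap.congr_fun hx (φ.smulRight e)
  exact smul_ne_zero hφ he this

/-- The dual of a projective functor is injective. -/
lemma injective_dual (P : GrFunctor K C') [Projective P] : Injective (dual E d.fwd P) where
  factors {A B} φ ι _ := by
    let ψ : P ⟶ dual E d.bwd A := eval E d.symm P ≫ dualMap E d.bwd φ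
    have : Epi (dualMap E d.bwd ι) :=
      epi_of_surjective _ (dualMap_surjective E d.bwd ι (app_injective_of_mono ι))
    let ψ' : P ⟶ dual E d.bwd B := Projective.factorThru ψ (dualMap E d.bwd ι)
    have hψ' : ψ' ≫ dualMap E d.bwd ι = ψ := Projective.factorThru_comp _ _
    refine ⟨eval E d B ≫ dualMap E d.fwd ψ', ?_⟩
    calc ι ≫ eval E d B ≫ dualMap E d.fwd ψ'
        = eval E d A ≫ dualMap E d.fwd ψ := by
          rw [← Category.assoc, ← eval_naturality, Category.assoc, ← dualMap_comp, hψ']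
      _ = (eval E d A ≫ dualMap E d.fwd (dualMap E d.bwd φ)) ≫
          dualMap E d.fwd (eval E d.symm P) :=
          (Category.assoc (eval E d A) (dualMap E d.fwd (dualMap E d.bwd φ))
            (dualMap E d.fwd (eval E d.symm P))).symm
      _ = (φ ≫ eval E d (dual E d.fwd P)) ≫ dualMap E d.fwd (eval E d.symm P) :=
          congrArg (· ≫ dualMap E d.fwd (eval E d.symm P)) (eval_naturality E d φ)
      _ = φ ≫ 𝟙 _ :=
          (Category.assoc φ (eval E d (dual E d.fwd P)) (dualMap E d.fwd (eval E d.symm P))).trans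
            (congrArg (φ ≫ ·) (eval_triangle E d P))
      _ = φ := Category.comp_id φ

/-- Every graded functor embeds into an injective one. -/
lemma exists_injective_embedding [Nontrivial E] (d : GradedDuality K C C')
    (hC' : DegreeZeroSemisimple K C')
    (F : GrFunctor K C) : ∃ (I : GrFunctor K C) (j : F ⟶ I), Injective I ∧
      ∀ X i, Function.Injective (j.app X i) := by
  obtain ⟨P, p, hP, hp, -⟩ := exists_epi_from_projective hC' (dual E d.bwd F)
  exact ⟨dual E d.fwd P, eval E d F ≫ dualMap E d.fwd p, injective_dual E d P, fun X i =>
    (dualMap_injective E d.fwd p hp X i).comp (eval_injective E d F X i)⟩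

/-- Duality turns projective dimension into injective dimension. -/
lemma hasInjectiveDimensionLE_dual (d : GradedDuality K C C')
    (hC' : DegreeZeroSemisimple K C') (n : ℕ) (S : GrFunctor K C')
    (hS : HasProjectiveDimensionLE S n) : HasInjectiveDimensionLE (dual E d.fwd S) n := by
  induction n generalizing S with
  | zero =>
    have := (projective_iff_hasProjectiveDimensionLE_zero S).2 hS
    have := injective_dual E d S
    exact inferInstanceAs (HasInjectiveDimensionLT (dual E d.fwd S) 1)
  | succ n ih =>
    obtain ⟨P, p, hP, hp, -⟩ := exists_epi_from_projective hC' S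
    have ex := shortExact_ker p hp
    obtain ⟨w, h⟩ := shortExact_dual E d.fwd ex
    exact (h.hasInjectiveDimensionLT_X₃_iff n (injective_dual E d P)).1
      (ih _ ((ex.hasProjectiveDimensionLT_X₃_iff n hP).1 hS))

lemma isAnnihilated_dual (τ : GradedContraFunctor K C C') {S : GrFunctor K C'}
    (hS : S.IsAnnihilated) : (dual E τ S).IsAnnihilated := by
  intro X Y i j k h f l hi
  refine LinearMap.ext fun x => ?_
  refine (congrArg (show S.obj (τ.obj Y) (-j) →ₗ[K] E from l)
    (hS (by omega) (τ.map f) x hi)).trans ?_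
  exact map_zero (show S.obj (τ.obj Y) (-j) →ₗ[K] E from l)

end GrFunctor

end

/-! ### Semisimplicity of the functors annihilated by positive degrees -/

namespace GrFunctor

variable {K : Type w} [Field K] {C : Type u} [Category.{v} C] [Preadditive C] [Linear K C]
  [GradedLinearCategory K C]

/-- The subfunctor generated by a homogeneous element. -/
def generated (F : GrFunctor K C) {Y : C} {d : ℤ} (x : F.obj Y d) : Subfunctor F where
  carrier X i := LinearMap.range ((reprDesc F x).app X i)
  map_mem := by
    rintro X Z i j k h f _ ⟨y, rfl⟩
    exact ⟨_, (reprDesc F x).naturality h f y⟩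

lemma self_mem_generated (F : GrFunctor K C) {Y : C} {d : ℤ} (x : F.obj Y d) :
    x ∈ (F.generated x).carrier Y d :=
  ⟨_, reprDesc_gen F x⟩

/-- If positive degrees act as zero, a homogeneous element `x` at a division object is a multiple of
each of its nonzero multiples. -/
lemma exists_map_eq (hpos : IsPositivelyGraded K C) {F : GrFunctor K C} (hF : F.IsAnnihilated)
    {Y : C} (hY : IsDivisionObject K Y) {d : ℤ} (x : F.obj Y d) {X : C} {i : ℤ} {y : F.obj X i}
    (hy : y ∈ (F.generated x).carrier X i) (hy0 : y ≠ 0) :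
    ∃ (j : ℤ) (h : j + i = d) (g : homDeg (K := K) Y X j), F.map h g y = x := by
  obtain ⟨(f : homDeg (K := K) X Y (i - d)), rfl⟩ := hy
  replace hy0 : F.map (sub_add_cancel i d) f x ≠ 0 := hy0
  change ∃ (j : ℤ) (h : j + i = d) (g : homDeg (K := K) Y X j),
    F.map h g (F.map (sub_add_cancel i d) f x) = x
  have hf0 : f.1 ≠ 0 := fun h => hy0 (by rw [show f = 0 from Subtype.ext h]; simp)
  obtain h | h | h := lt_trichotomy (i - d) 0
  · exact absurd (eq_zero_of_neg hpos h f.2) hf0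
  · obtain ⟨g, hg, e⟩ := hY.2 (h ▸ f.2) hf0
    refine ⟨0, by omega, ⟨g, hg⟩, ?_⟩
    exact (F.map_map _ _ (zero_add d) (by omega) (e := ⟨𝟙 Y, id_mem Y⟩) e x).trans (F.map_id _ _ x)
  · exact absurd (hF _ f x h) hy0

/-- A nonzero homogeneous element at a division object generates a simple functor, if positive
degrees act as zero. -/
lemma simple_generated (hpos : IsPositivelyGraded K C) {F : GrFunctor K C} (hF : F.IsAnnihilated)
    {Y : C} (hY : IsDivisionObject K Y) {d : ℤ} {x : F.obj Y d} (hx : x ≠ 0) :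
    Simple (F.generated x).toFunctor where
  mono_isIso_iff_nonzero {A} η _ := by
    constructor
    · rintro hi rfl
      have h0 : 𝟙 (F.generated x).toFunctor = 0 := by
        rw [← IsIso.inv_hom_id (0 : A ⟶ (F.generated x).toFunctor), comp_zero]
      exact hx (congrArg (fun ζ : (F.generated x).toFunctor ⟶ (F.generated x).toFunctor =>
        (ζ.app Y d ⟨x, F.self_mem_generated x⟩).1) h0)
    · intro hη
      obtain ⟨X, i, a, ha⟩ : ∃ X i a, η.app X i a ≠ 0 := by
        by_contra! h
        exact hη (by ext X i a; exact h X i a)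
      -- the generator is in the image
      obtain ⟨j, h, g, hg⟩ := exists_map_eq hpos hF hY x (η.app X i a).2
        (fun h => ha (Subtype.ext h))
      have hxa : (η.app Y d (A.map h g a)).1 = x := by
        rw [η.naturality]
        exact hg
      have : Epi η := by
        refine epi_of_surjective η fun Z k => ?_
        rintro ⟨_, (f : homDeg (K := K) Z Y (k - d)), rfl⟩
        refine ⟨A.map (sub_add_cancel k d) f (A.map h g a), Subtype.ext ?_⟩
        rw [η.naturality]
        exact congrArg (F.map (sub_add_cancel k d) f) hxa
      exact isIso_of_mono_of_epi η

/-- A decomposition of the identity of `X` in degree zero decomposes the elements at `X`. -/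
lemma sum_map_map (F : GrFunctor K C) {X : C} {n : ℕ} {Y : Fin n → C} {p : ∀ a, X ⟶ Y a}
    {r : ∀ a, Y a ⟶ X} (hp : ∀ a, p a ∈ homDeg (K := K) X (Y a) 0)
    (hr : ∀ a, r a ∈ homDeg (K := K) (Y a) X 0) (e : ∑ a, p a ≫ r a = 𝟙 X) {i : ℤ}
    (x : F.obj X i) :
    ∑ a, F.map (zero_add i) ⟨p a, hp a⟩ (F.map (zero_add i) ⟨r a, hr a⟩ x) = x := by
  have h1 : ∀ a, F.map (zero_add i) ⟨p a, hp a⟩ (F.map (zero_add i) ⟨r a, hr a⟩ x) =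
      F.map (zero_add i) ⟨p a ≫ r a, by simpa using comp_mem (hp a) (hr a)⟩ x := fun a =>
    F.map_map _ _ _ (add_zero 0) rfl x
  simp_rw [h1]
  rw [← LinearMap.sum_apply, ← map_sum]
  refine F.map_eq_self _ ?_ x
  rw [← e]
  simp

/-- Every subfunctor of a functor annihilated by positive degrees has a complement. -/
lemma exists_complement (hC : DegreeZeroSemisimple K C) {F : GrFunctor K C} (hF : F.IsAnnihilated)
    (A : Subfunctor F) : ∃ N : Subfunctor F, ∀ X i, IsCompl (A.carrier X i) (N.carrier X i) := by
  -- a subfunctor maximal among those meeting `A` trivially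
  let P : Set (∀ X i, Submodule K (F.obj X i)) :=
    {N | (∀ {X Y : C} {i j k : ℤ} (h : i + j = k) (f : homDeg (K := K) X Y i) {x : F.obj Y j},
      x ∈ N Y j → F.map h f x ∈ N X k) ∧ ∀ X i, Disjoint (A.carrier X i) (N X i)}
  obtain ⟨N, hN⟩ : ∃ N, Maximal (· ∈ P) N := by
    refine zorn_le₀ P fun c hc hchain => ?_
    rcases c.eq_empty_or_nonempty with rfl | hne
    · exact ⟨fun X i => ⊥, ⟨fun h f x hx => by
        rw [Submodule.mem_bot] at hx ⊢
        rw [hx, map_zero], fun X i => disjoint_bot_right⟩, by simp⟩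
    have mem_sSup : ∀ {X i} {x : F.obj X i}, x ∈ (sSup c) X i ↔ ∃ N ∈ c, x ∈ N X i := by
      intro X i x
      have : Nonempty c := hne.to_subtype
      rw [sSup_apply, iSup_apply, Submodule.mem_iSup_of_directed _ fun a b => ?_]
      · simp
      · rcases hchain.total a.2 b.2 with h | h
        · exact ⟨b, h X i, le_rfl⟩
        · exact ⟨a, le_rfl, h X i⟩
    refine ⟨sSup c, ⟨fun h f x hx => ?_, fun X i => ?_⟩, fun N hN => le_sSup hN⟩
    · obtain ⟨N, hN, hx⟩ := mem_sSup.1 hx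
      exact mem_sSup.2 ⟨N, hN, (hc hN).1 h f hx⟩
    · rw [Submodule.disjoint_def]
      intro x hxA hx
      obtain ⟨N, hN, hx⟩ := mem_sSup.1 hx
      exact Submodule.disjoint_def.1 ((hc hN).2 X i) x hxA hx
  refine ⟨⟨N, hN.prop.1⟩, fun X i => ⟨hN.prop.2 X i, ?_⟩⟩
  rw [codisjoint_iff, eq_top_iff]
  have sup_map : ∀ {X Z : C} {i j k : ℤ} (h : i + j = k) (f : homDeg (K := K) X Z i)
      {x : F.obj Z j}, x ∈ A.carrier Z j ⊔ N Z j → F.map h f x ∈ A.carrier X k ⊔ N X k := by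
    intro X Z i j k h f x hx
    obtain ⟨a, ha, b, hb, rfl⟩ := Submodule.mem_sup.1 hx
    rw [map_add]
    exact Submodule.add_mem_sup (A.map_mem h f ha) (hN.prop.1 h f hb)
  -- by maximality `A + N` contains every homogeneous element at a division object
  have key : ∀ (Y : C), IsDivisionObject K Y → ∀ (d : ℤ) (x : F.obj Y d),
      x ∈ A.carrier Y d ⊔ N Y d := by
    intro Y hY d x
    by_contra hx
    have hmem : (fun X i => N X i ⊔ (F.generated x).carrier X i) ∈ P := by
      refine ⟨fun {X Z i j k} h f y hy => ?_, fun X i => ?_⟩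
      · obtain ⟨a, ha, b, hb, rfl⟩ := Submodule.mem_sup.1 hy
        rw [map_add]
        exact Submodule.add_mem_sup (hN.prop.1 h f ha) ((F.generated x).map_mem h f hb)
      · rw [Submodule.disjoint_def]
        intro y hyA hy
        obtain ⟨a, ha, b, hb, rfl⟩ := Submodule.mem_sup.1 hy
        by_cases hb0 : b = 0
        · rw [hb0, add_zero] at hyA ⊢
          exact Submodule.disjoint_def.1 (hN.prop.2 X i) a hyA ha
        · obtain ⟨j, h, g, hg⟩ := exists_map_eq hC.pos hF hY x hb hb0
          refine absurd ?_ hx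
          rw [← hg]
          apply sup_map
          rw [← add_sub_cancel_left a b]
          exact sub_mem (Submodule.mem_sup_left hyA) (Submodule.mem_sup_right ha)
    have hle := hN.le_of_ge hmem (fun X i => le_sup_left)
    exact hx (Submodule.mem_sup_right
      (hle Y d (Submodule.mem_sup_right (F.self_mem_generated x))))
  intro x _
  obtain ⟨n, Y, p, r, hp, hr, e, hY⟩ := hC.decomp X
  rw [← sum_map_map F hp hr e x]
  exact sum_mem fun a _ => sup_map _ _ (key (Y a) (hY a) i _)

/-- Monomorphisms into functors annihilated by positive degrees split. -/
lemma exists_retraction_of_isAnnihilated (hC : DegreeZeroSemisimple K C) {A B : GrFunctor K C}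
    (hB : B.IsAnnihilated) (η : A ⟶ B) (hη : ∀ X i, Function.Injective (η.app X i)) :
    ∃ r : B ⟶ A, η ≫ r = 𝟙 A := by
  let R : Subfunctor B :=
    { carrier := fun X i => LinearMap.range (η.app X i)
      map_mem := by
        rintro X Y i j k h f _ ⟨a, rfl⟩
        exact ⟨_, η.naturality h f a⟩ }
  obtain ⟨N, hN⟩ := exists_complement hC hB R
  -- every element is the sum of an element of the image and an element of the complement
  have split : ∀ X i (b : B.obj X i), ∃ a, b - η.app X i a ∈ N.carrier X i := by
    intro X i b
    have hb : b ∈ R.carrier X i ⊔ N.carrier X i := by rw [(hN X i).sup_eq_top]; trivial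
    obtain ⟨_, ⟨a, rfl⟩, c, hc, rfl⟩ := Submodule.mem_sup.1 hb
    exact ⟨a, by simpa using hc⟩
  have uniq : ∀ X i (a : A.obj X i), η.app X i a ∈ N.carrier X i → a = 0 := by
    intro X i a ha
    apply hη X i
    rw [map_zero]
    exact Submodule.disjoint_def.1 (hN X i).disjoint _ ⟨a, rfl⟩ ha
  have uniq' : ∀ X i (b : B.obj X i) (a a' : A.obj X i), b - η.app X i a ∈ N.carrier X i →
      b - η.app X i a' ∈ N.carrier X i → a = a' := by
    intro X i b a a' h h'
    rw [← sub_eq_zero]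
    apply uniq
    have := sub_mem h' h
    rwa [sub_sub_sub_cancel_left, ← map_sub] at this
  choose r hr using split
  refine ⟨⟨fun X i => ⟨⟨r X i, fun b b' => ?_⟩, fun c b => ?_⟩, fun {X Y i j k} h f b => ?_⟩, ?_⟩
  · refine uniq' X i (b + b') _ _ (hr X i _) ?_
    rw [map_add, add_sub_add_comm]
    exact add_mem (hr X i b) (hr X i b')
  · refine uniq' X i (c • b) _ _ (hr X i _) ?_
    rw [RingHom.id_apply, map_smul, ← smul_sub]
    exact Submodule.smul_mem _ _ (hr X i b)
  · refine uniq' X k (B.map h f b) _ _ (hr X k _) ?_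
    rw [η.naturality, ← map_sub]
    exact N.map_mem h f (hr Y j b)
  · ext X i a
    refine uniq' X i (η.app X i a) _ _ (hr X i _) ?_
    simp

/-- If all simple functors have projective dimension at most `n`, then so do all functors
annihilated by positive degrees, being direct summands of direct sums of simple ones. -/
lemma hasProjectiveDimensionLE_of_isAnnihilated (hC : DegreeZeroSemisimple K C) {n : ℕ}
    (h : ∀ S : GrFunctor K C, Simple S → HasProjectiveDimensionLE S n) {F : GrFunctor K C}
    (hF : F.IsAnnihilated) : HasProjectiveDimensionLE F n := by
  obtain ⟨T, Z, hZ⟩ := hC.small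
  choose m Y p r hp hr e hY using fun t => hC.decomp (Z t)
  let Y' : (Σ t : T, Fin (m t)) → C := fun s => Y s.1 s.2
  let G : CoverIndex Y' F → GrFunctor K C := fun s => (F.generated s.2.2.1).toFunctor
  let η : ∀ s, G s ⟶ F := fun s => (F.generated s.2.2.1).ι
  have hG : (directSum G).IsAnnihilated := by
    intro X W i j k h f x hi
    exact DFinsupp.ext fun s => Subtype.ext (hF h f _ hi)
  have hdesc : ∀ X i, Function.Surjective ((directSumDesc G η).app X i) := by
    intro X i x
    change x ∈ LinearMap.range ((directSumDesc G η).app X i)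
    have range_map : ∀ {X W : C} {i j k : ℤ} (h : i + j = k) (f : homDeg (K := K) X W i)
        {x : F.obj W j}, x ∈ LinearMap.range ((directSumDesc G η).app W j) →
          F.map h f x ∈ LinearMap.range ((directSumDesc G η).app X k) := by
      rintro X W i j k h f _ ⟨x, rfl⟩
      exact ⟨_, (directSumDesc G η).naturality h f x⟩
    obtain ⟨t, q, q', hq, hq', e'⟩ := hZ X
    have hx : F.map (zero_add i) ⟨q, hq⟩ (F.map (zero_add i) ⟨q', hq'⟩ x) = x := by
      rw [F.map_map _ _ (zero_add i) (add_zero 0) (e := ⟨𝟙 X, id_mem X⟩) e', F.map_id]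
    rw [← hx]
    refine range_map _ _ ?_
    rw [← sum_map_map F (hp t) (hr t) (e t) (F.map (zero_add i) ⟨q', hq'⟩ x)]
    refine sum_mem fun a _ => range_map _ _ ?_
    generalize F.map (zero_add i) _ _ = y
    by_cases hy : y = 0
    · rw [hy]
      exact zero_mem _
    · let s : CoverIndex Y' F := ⟨⟨t, a⟩, i, y, hy⟩
      exact ⟨(directSumι G s).app (Y t a) i ⟨y, F.self_mem_generated y⟩,
        directSumDesc_app_ι G η s _⟩
  have hpd := hasProjectiveDimensionLE_directSum G hC n fun s =>
    h _ (simple_generated hC.pos hF (hY s.1.1 s.1.2) s.2.2.2)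
  have ex := shortExact_ker (directSumDesc G η) hdesc
  obtain ⟨ρ, hρ⟩ := exists_retraction_of_isAnnihilated hC hG (kerι (directSumDesc G η))
    fun _ _ => Subtype.val_injective
  let σ := ShortComplex.Splitting.ofExactOfRetraction _ ex.exact ρ hρ ex.epi_g
  exact (Retract.mk σ.s (directSumDesc G η) σ.s_g).hasProjectiveDimensionLT (n + 1)

end GrFunctor

/-! ### Projectivity and injectivity detected on filtrations by degree -/

section Ext

universe t

variable {A : Type u} [Category.{v} A] [Abelian A] [HasExt.{t} A]

lemma exists_lift_of_ext_eq_zero {S : ShortComplex A} (hS : S.ShortExact) {X : A}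
    (h : ∀ e : Abelian.Ext.{t} X S.X₁ 1, e = 0) (f : X ⟶ S.X₃) : ∃ g : X ⟶ S.X₂, g ≫ S.g = f := by
  obtain ⟨x, hx⟩ := Abelian.Ext.covariant_sequence_exact₃ X hS (Abelian.Ext.mk₀ f) (zero_add 1)
    (h _)
  obtain ⟨g, rfl⟩ := Abelian.Ext.addEquiv₀.symm.surjective x
  refine ⟨g, Abelian.Ext.addEquiv₀.symm.injective ?_⟩
  simpa using hx

lemma exists_extension_of_ext_eq_zero {S : ShortComplex A} (hS : S.ShortExact) {Y : A}
    (h : ∀ e : Abelian.Ext.{t} S.X₃ Y 1, e = 0) (f : S.X₁ ⟶ Y) : ∃ g : S.X₂ ⟶ Y, S.f ≫ g = f := by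
  obtain ⟨x, hx⟩ := Abelian.Ext.contravariant_sequence_exact₁ hS Y (Abelian.Ext.mk₀ f) (add_zero 1)
    (h _)
  obtain ⟨g, rfl⟩ := Abelian.Ext.addEquiv₀.symm.surjective x
  refine ⟨g, Abelian.Ext.addEquiv₀.symm.injective ?_⟩
  simpa using hx

end Ext

namespace GrFunctor

universe t

variable {K : Type w} [Field K] {C : Type u} [Category.{v} C] [Preadditive C] [Linear K C]
  [GradedLinearCategory K C]

lemma map_eq_zero_of_neg (hpos : IsPositivelyGraded K C) (F : GrFunctor K C) {X Y : C}
    {i j k : ℤ} (h : i + j = k) (f : homDeg (K := K) X Y i) (x : F.obj Y j) (hi : i < 0) :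
    F.map h f x = 0 := by
  rw [show f = 0 from Subtype.ext (eq_zero_of_neg hpos hi f.2), map_zero, LinearMap.zero_apply]

variable [HasExt.{t} (GrFunctor K C)]

/-- A bounded below functor `M` without first extensions by functors annihilated by positive degrees
is projective. For an epimorphism `p` from a bounded below projective `P`, a section of `p` is
built by lifting successively to the quotients of `P` by the part of `ker p` in degrees
`≥ m + l`; consecutive quotients differ by a functor concentrated in one degree, and the process
is stationary in each degree. -/
lemma projective_of_ext_eq_zero (hC : DegreeZeroSemisimple K C) {M : GrFunctor K C}
    (hM : M.IsBoundedBelow)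
    (h : ∀ G : GrFunctor K C, G.IsAnnihilated → ∀ e : Abelian.Ext.{t} M G 1, e = 0) :
    Projective M := by
  obtain ⟨m, hm⟩ := hM
  obtain ⟨P, p, hP, hp, hPm⟩ := exists_epi_from_projective hC M
  replace hPm := hPm m hm
  let Q : ℕ → Subfunctor P := fun l =>
    { carrier := fun X i => if m + l ≤ i then LinearMap.ker (p.app X i) else ⊥
      map_mem := by
        intro X Y i j k hk f x hx
        rcases lt_or_ge i 0 with hi | hi
        · rw [map_eq_zero_of_neg hC.pos P hk f x hi]
          exact zero_mem _
        · split_ifs at hx with hj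
          · rw [if_pos (by omega), LinearMap.mem_ker, p.naturality, LinearMap.mem_ker.1 hx,
              map_zero]
          · rw [(Submodule.mem_bot K).1 hx, map_zero]
            exact zero_mem _ }
  have hQ : ∀ {l X i} {x : P.obj X i}, x ∈ (Q l).carrier X i ↔
      p.app X i x = 0 ∧ (i < m + l → x = 0) := by
    intro l X i x
    change x ∈ (if m + l ≤ i then LinearMap.ker (p.app X i) else ⊥) ↔ _
    split_ifs with hi
    · simp [hi]
    · simp only [Submodule.mem_bot, not_le.1 hi, forall_const]
      exact ⟨fun hx => ⟨by rw [hx, map_zero], hx⟩, fun hx => hx.2⟩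
  let q : (Q 0).quotient ⟶ M := (Q 0).desc p fun X i x hx => (hQ.1 hx).1
  let τ : ∀ l, (Q (l + 1)).quotient ⟶ (Q l).quotient := fun l =>
    (Q (l + 1)).desc (Q l).π fun X i x hx => (Q l).π_eq_zero_iff.2
      (hQ.2 ⟨(hQ.1 hx).1, fun hi => (hQ.1 hx).2 (by push_cast; omega)⟩)
  -- `P` and `M` agree below degree `m`, so the first quotient is `M` itself
  have hq : IsIso q := by
    have : Mono q := by
      refine mono_of_injective q fun X i => (injective_iff_map_eq_zero _).2 fun x hx => ?_
      obtain ⟨x, rfl⟩ := (Q 0).π_surjective X i x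
      exact (Q 0).π_eq_zero_iff.2 (hQ.2 ⟨hx, fun hi => hPm X i (by simpa using hi) x⟩)
    have : Epi q := by
      refine epi_of_surjective q fun X i x => ?_
      obtain ⟨y, rfl⟩ := hp X i x
      exact ⟨(Q 0).π.app X i y, rfl⟩
    exact isIso_of_mono_of_epi q
  have hτ : ∀ l X i, Function.Surjective ((τ l).app X i) := by
    intro l X i x
    obtain ⟨x, rfl⟩ := (Q l).π_surjective X i x
    exact ⟨(Q (l + 1)).π.app X i x, rfl⟩
  have hker : ∀ l, (ker (τ l)).IsAnnihilated := by
    intro l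
    have conc : ∀ X i (x : (ker (τ l)).obj X i), i ≠ m + l → x = 0 := by
      rintro X i ⟨x, hx⟩ hi
      obtain ⟨x, rfl⟩ := (Q (l + 1)).π_surjective X i x
      have hx' := hQ.1 ((Q l).π_eq_zero_iff.1 hx)
      refine Subtype.ext ((Q (l + 1)).π_eq_zero_iff.2 (hQ.2 ⟨hx'.1, fun hi' => hx'.2 ?_⟩))
      push_cast at hi'
      omega
    intro X Y i j k hk f x hi
    by_cases hj : j = m + l
    · exact conc _ _ _ (by omega)
    · rw [conc _ _ x hj, map_zero]
  choose nxt hnxt using fun l (s : M ⟶ (Q l).quotient) =>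
    exists_lift_of_ext_eq_zero (shortExact_ker (τ l) (hτ l)) (h _ (hker l)) s
  let s : ∀ l, M ⟶ (Q l).quotient := fun l => Nat.rec (inv q) (fun l s => nxt l s) l
  have hs : ∀ l, s (l + 1) ≫ τ l = s l := fun l => hnxt l (s l)
  have compat : ∀ {X i} (x : M.obj X i) (y : P.obj X i) {l l' : ℕ}, l ≤ l' →
      (Q l').π.app X i y = (s l').app X i x → (Q l).π.app X i y = (s l).app X i x := by
    intro X i x y l l' hl
    induction l', hl using Nat.le_induction with
    | base => exact id
    | succ l' _ ih =>
      intro hy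
      apply ih
      rw [← hs l']
      exact congrArg ((τ l').app X i) hy
  have inj : ∀ {X i} {y y' : P.obj X i} (l : ℕ), i < m + l →
      (Q l).π.app X i y = (Q l).π.app X i y' → y = y' := by
    intro X i y y' l hl hy
    rw [← sub_eq_zero, ← map_sub, (Q l).π_eq_zero_iff, hQ] at hy
    exact sub_eq_zero.1 (hy.2 hl)
  have ex : ∀ X i (x : M.obj X i), ∃ y : P.obj X i, ∀ l, (Q l).π.app X i y = (s l).app X i x := by
    intro X i x
    let L := (i - m + 1).toNat
    obtain ⟨y, hy⟩ := (Q L).π_surjective X i ((s L).app X i x)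
    refine ⟨y, fun l => ?_⟩
    obtain ⟨y', hy'⟩ := (Q (max l L)).π_surjective X i ((s (max l L)).app X i x)
    have : y = y' := inj L (by omega) (hy.trans (compat x y' (le_max_right l L) hy').symm)
    rw [this]
    exact compat x y' (le_max_left l L) hy'
  have uniq : ∀ {X i} {y y' : P.obj X i},
      (∀ l, (Q l).π.app X i y = (Q l).π.app X i y') → y = y' := fun {X i} y y' hy =>
    inj (i - m + 1).toNat (by omega) (hy _)
  choose r hr using ex
  let ρ : M ⟶ P :=
    ⟨fun X i => ⟨⟨r X i, fun x x' => uniq fun l => by simp only [hr, map_add]⟩,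
      fun c x => uniq fun l => by simp only [hr, map_smul, RingHom.id_apply]⟩,
      fun hk f x => uniq fun l => by
        refine (hr _ _ _ l).trans ?_
        rw [(Q l).π.naturality, (s l).naturality]
        exact congrArg _ (hr _ _ x l).symm⟩
  have hρ : ρ ≫ p = 𝟙 M := by
    ext X i x
    refine (congrArg (q.app X i) (hr X i x 0)).trans ?_
    exact congrArg (fun ζ : M ⟶ M => ζ.app X i x) (IsIso.inv_hom_id q)
  exact (Retract.mk ρ p hρ).projective

/-- A functor `G` such that bounded below functors have no first extensions by `G` is injective.
A morphism `A ⟶ G` on a subfunctor of `B` is extended successively to the subfunctors generated by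
`A` and the part of `B` in degrees `≥ -k`. -/
lemma injective_of_ext_eq_zero (hpos : IsPositivelyGraded K C) {G : GrFunctor K C}
    (h : ∀ B : GrFunctor K C, B.IsBoundedBelow → ∀ e : Abelian.Ext.{t} B G 1, e = 0) :
    Injective G where
  factors {A B} f η _ := by
    have extend : ∀ {A B : GrFunctor K C} (η : A ⟶ B), (∀ X i, Function.Injective (η.app X i)) →
        ∀ (m : ℤ), (∀ X i, i < m → Function.Surjective (η.app X i)) →
          ∀ f : A ⟶ G, ∃ g : B ⟶ G, η ≫ g = f := by
      intro A B η hη m hm f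
      refine exists_extension_of_ext_eq_zero (shortExact_coker η hη) (h _ ⟨m, fun X i hi x => ?_⟩) f
      obtain ⟨x, rfl⟩ := Submodule.mkQ_surjective _ x
      exact (Submodule.Quotient.mk_eq_zero _).2 (hm X i hi x)
    let R : ℕ → Subfunctor B := fun l =>
      { carrier := fun X i => if -(l : ℤ) ≤ i then ⊤ else LinearMap.range (η.app X i)
        map_mem := by
          intro X Y i j k hk f x hx
          rcases lt_or_ge i 0 with hi | hi
          · rw [map_eq_zero_of_neg hpos B hk f x hi]
            exact zero_mem _
          · by_cases hk' : -(l : ℤ) ≤ k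
            · rw [if_pos hk']
              trivial
            · rw [if_neg (by omega)] at hx
              rw [if_neg hk']
              obtain ⟨a, rfl⟩ := hx
              exact ⟨_, η.naturality hk f a⟩ }
    have hR : ∀ {l X i} {x : B.obj X i}, x ∈ (R l).carrier X i ↔
        -(l : ℤ) ≤ i ∨ x ∈ LinearMap.range (η.app X i) := by
      intro l X i x
      change x ∈ (if -(l : ℤ) ≤ i then ⊤ else LinearMap.range (η.app X i)) ↔ _
      split_ifs with hi <;> simp [hi]
    let j : A ⟶ (R 0).toFunctor := (R 0).lift η fun X i x => hR.2 (Or.inr ⟨x, rfl⟩)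
    have hRle : ∀ {l l' X i} {x : B.obj X i}, l ≤ l' → x ∈ (R l).carrier X i →
        x ∈ (R l').carrier X i := fun hl hx => hR.2 ((hR.1 hx).imp_left fun hi => by omega)
    let τ : ∀ l, (R l).toFunctor ⟶ (R (l + 1)).toFunctor := fun l =>
      (R (l + 1)).lift (R l).ι fun X i x => hRle l.le_succ x.2
    obtain ⟨g₀, hg₀⟩ := extend j
      (fun X i a b hab => app_injective_of_mono η X i (congrArg Subtype.val hab)) 0 (by
        rintro X i hi ⟨x, hx⟩
        obtain ⟨a, rfl⟩ := (hR.1 hx).resolve_left (by push_cast; omega)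
        exact ⟨a, rfl⟩) f
    choose nxt hnxt using fun l (g : (R l).toFunctor ⟶ G) =>
      extend (τ l) (fun X i a b hab => Subtype.ext
        (congrArg (fun z : (R (l + 1)).carrier X i => z.1) hab)) (-(l + 1)) (by
        rintro X i hi ⟨x, hx⟩
        exact ⟨⟨x, hR.2 (Or.inr ((hR.1 hx).resolve_left (by push_cast; omega)))⟩, rfl⟩) g
    let g : ∀ l, (R l).toFunctor ⟶ G := fun l => Nat.rec g₀ (fun l g => nxt l g) l
    have hg : ∀ l, τ l ≫ g (l + 1) = g l := fun l => hnxt l (g l)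
    have compat : ∀ {X i} {x : B.obj X i} {l l' : ℕ} (hl : l ≤ l') (hx : x ∈ (R l).carrier X i),
        (g l').app X i ⟨x, hRle hl hx⟩ = (g l).app X i ⟨x, hx⟩ := by
      intro X i x l l' hl hx
      induction l', hl using Nat.le_induction with
      | base => rfl
      | succ l' hl ih =>
        rw [← ih, ← hg l']
        rfl
    have ex : ∀ X i (x : B.obj X i), ∃ y : G.obj X i, ∀ l (hx : x ∈ (R l).carrier X i),
        (g l).app X i ⟨x, hx⟩ = y := by
      intro X i x
      refine ⟨(g (-i).toNat).app X i ⟨x, hR.2 (Or.inl (by omega))⟩, fun l hx => ?_⟩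
      rw [← compat (le_max_left l (-i).toNat) hx, ← compat (le_max_right l (-i).toNat)]
    choose r hr using ex
    refine ⟨⟨fun X i => ⟨⟨r X i, fun x x' => ?_⟩, fun c x => ?_⟩, fun {X Y i j k} hk φ x => ?_⟩, ?_⟩
    · have hx : ∀ x : B.obj X i, x ∈ (R (-i).toNat).carrier X i := fun x => hR.2 (Or.inl (by omega))
      rw [← hr X i _ _ (hx _), ← hr X i _ _ (hx _), ← hr X i _ _ (hx _)]
      exact map_add ((g (-i).toNat).app X i) ⟨x, hx x⟩ ⟨x', hx x'⟩
    · have hx : ∀ x : B.obj X i, x ∈ (R (-i).toNat).carrier X i := fun x => hR.2 (Or.inl (by omega))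
      change r X i (c • x) = c • r X i x
      rw [← hr X i x _ (hx x), ← hr X i (c • x) _ (hx _)]
      exact map_smul ((g (-i).toNat).app X i) c ⟨x, hx x⟩
    · let l := max (-j).toNat (-k).toNat
      have hx : x ∈ (R l).carrier Y j := hR.2 (Or.inl (by omega))
      have hx' : B.map hk φ x ∈ (R l).carrier X k := hR.2 (Or.inl (by omega))
      refine (hr X k _ l hx').symm.trans (((g l).naturality hk φ ⟨x, hx⟩).trans ?_)
      exact congrArg _ (hr Y j x l hx)
    · ext X i a
      refine (hr X i _ 0 (hR.2 (Or.inr ⟨a, rfl⟩))).symm.trans ?_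
      exact congrArg (fun ζ : A ⟶ G => ζ.app X i a) hg₀

/-- Dimension shifting for `projective_of_ext_eq_zero`. -/
lemma hasProjectiveDimensionLE_of_ext_eq_zero (hC : DegreeZeroSemisimple K C) (n : ℕ)
    {M : GrFunctor K C} (hM : M.IsBoundedBelow)
    (h : ∀ G : GrFunctor K C, G.IsAnnihilated → ∀ e : Abelian.Ext.{t} M G (n + 1), e = 0) :
    HasProjectiveDimensionLE M n := by
  induction n generalizing M with
  | zero =>
    exact (projective_iff_hasProjectiveDimensionLE_zero M).1 (projective_of_ext_eq_zero hC hM h)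
  | succ n ih =>
    obtain ⟨P, p, hP, hp, hPm⟩ := exists_epi_from_projective hC M
    have ex := shortExact_ker p hp
    refine (ex.hasProjectiveDimensionLT_X₃_iff n hP).2 (ih ?_ fun G hG e => ?_)
    · obtain ⟨m, hm⟩ := hM
      exact ⟨m, fun X i hi x => Subtype.ext (hPm m hm X i hi x.1)⟩
    · obtain ⟨x, rfl⟩ := Abelian.Ext.contravariant_sequence_exact₁ ex G e (add_comm 1 (n + 1))
        (h G hG _)
      rw [Abelian.Ext.eq_zero_of_projective x, Abelian.Ext.comp_zero]

/-- Dimension shifting for `injective_of_ext_eq_zero`. -/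
lemma hasInjectiveDimensionLE_of_ext_eq_zero (hpos : IsPositivelyGraded K C)
    (hinj : ∀ F : GrFunctor K C, ∃ (I : GrFunctor K C) (j : F ⟶ I), Injective I ∧
      ∀ X i, Function.Injective (j.app X i)) (n : ℕ) {G : GrFunctor K C}
    (h : ∀ B : GrFunctor K C, B.IsBoundedBelow → ∀ e : Abelian.Ext.{t} B G (n + 1), e = 0) :
    HasInjectiveDimensionLE G n := by
  induction n generalizing G with
  | zero =>
    have := injective_of_ext_eq_zero hpos h
    exact inferInstanceAs (HasInjectiveDimensionLT G 1)
  | succ n ih =>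
    obtain ⟨I, j, hI, hj⟩ := hinj G
    have ex := shortExact_coker j hj
    refine (ex.hasInjectiveDimensionLT_X₃_iff n hI).1 (ih fun B hB e => ?_)
    obtain ⟨x, rfl⟩ := Abelian.Ext.covariant_sequence_exact₃ B ex e rfl (h B hB _)
    rw [Abelian.Ext.eq_zero_of_injective x, Abelian.Ext.zero_comp]

end GrFunctor

/-! ### Global dimension -/

namespace GrFunctor

section

variable {K : Type w} [Field K] {C C' : Type u} [Category.{v} C] [Category.{v} C']
  [Preadditive C] [Preadditive C'] [Linear K C] [Linear K C']
  [GradedLinearCategory K C] [GradedLinearCategory K C']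

/-- A bound for the projective dimensions of the simple functors on one side of a duality is a bound
for the projective dimensions of all functors on the other side. -/
theorem hasProjectiveDimensionLE_of_simple (d : GradedDuality K C C')
    (hC : DegreeZeroSemisimple K C) (hC' : DegreeZeroSemisimple K C')
    (E : Type v) [AddCommGroup E] [Module K E] [Nontrivial E] {n : ℕ}
    (h : ∀ S : GrFunctor K C', Simple S → HasProjectiveDimensionLE S n) (F : GrFunctor K C) :
    HasProjectiveDimensionLE F n := by
  have := HasExt.standard (GrFunctor K C)
  -- a functor annihilated by positive degrees is a direct summand of its double dual
  have hid : ∀ G : GrFunctor K C, G.IsAnnihilated → HasInjectiveDimensionLE G n := by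
    intro G hG
    have hD := isAnnihilated_dual E d.bwd hG
    obtain ⟨r, hr⟩ := exists_retraction_of_isAnnihilated hC (isAnnihilated_dual E d.fwd hD)
      (eval E d G) (eval_injective E d G)
    have := hasInjectiveDimensionLE_dual E d hC' n _
      (hasProjectiveDimensionLE_of_isAnnihilated hC' h hD)
    exact (Retract.mk (eval E d G) r hr).hasInjectiveDimensionLT (n + 1)
  have hpd : ∀ M : GrFunctor K C, M.IsBoundedBelow → HasProjectiveDimensionLE M n := fun M hM =>
    hasProjectiveDimensionLE_of_ext_eq_zero hC n hM fun G hG e =>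
      have := hid G hG
      e.eq_zero_of_hasInjectiveDimensionLT (n + 1) le_rfl
  have hall : ∀ G : GrFunctor K C, HasInjectiveDimensionLE G n := fun G =>
    hasInjectiveDimensionLE_of_ext_eq_zero hC.pos (exists_injective_embedding E d hC') n
      fun B hB e =>
        have := hpd B hB
        e.eq_zero_of_hasProjectiveDimensionLT (n + 1) le_rfl
  exact HasProjectiveDimensionLT.mk fun i hi G e =>
    have := hall G
    e.eq_zero_of_hasInjectiveDimensionLT (n + 1) hi

lemma globalDimension_le_iff {n : ℕ} : globalDimension (GrFunctor K C) ≤ n ↔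
    ∀ F : GrFunctor K C, HasProjectiveDimensionLE F n := by
  simp only [globalDimension, iSup_le_iff, projectiveDimension_le_iff]

lemma globalDimension_eq_bot_iff :
    globalDimension (GrFunctor K C) = ⊥ ↔ ∀ X : C, 𝟙 X = 0 := by
  simp only [globalDimension, iSup_eq_bot, projectiveDimension_eq_bot_iff]
  constructor
  · intro h X
    have h0 := (IsZero.iff_id_eq_zero _).1 (h (repr (K := K) X 0))
    exact congrArg Subtype.val (congrArg (fun ζ : repr (K := K) X 0 ⟶ repr X 0 =>
      ζ.app X 0 (reprGen X 0)) h0)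
  · intro h F
    rw [IsZero.iff_id_eq_zero]
    ext X i x
    change x = 0
    rw [← F.map_id X i x, show (⟨𝟙 X, id_mem X⟩ : homDeg (K := K) X X 0) = 0 from
      Subtype.ext (h X), map_zero, LinearMap.zero_apply]

end

section

variable {K : Type w} [Field K] {C : Type u} [Category.{v} C] [Preadditive C] [Linear K C]
  [GradedLinearCategory K C]

/-- The two global dimensions agree: a global dimension bounds the projective dimensions of simple
functors, hence the global dimension on the other side. -/
theorem globalDimension_op_eq (hC : DegreeZeroSemisimple K C) :
    globalDimension (GrFunctor K C) = globalDimension (GrFunctor K Cᵒᵖ) := by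
  by_cases h0 : ∀ X : C, 𝟙 X = 0
  · rw [globalDimension_eq_bot_iff.2 h0, globalDimension_eq_bot_iff.2 fun X =>
      Quiver.Hom.unop_inj (h0 X.unop)]
  · have h1 : globalDimension (GrFunctor K C) ≠ ⊥ := fun h => h0 (globalDimension_eq_bot_iff.1 h)
    have h2 : globalDimension (GrFunctor K Cᵒᵖ) ≠ ⊥ := fun h => h0 fun X =>
      Quiver.Hom.op_inj (globalDimension_eq_bot_iff.1 h (Opposite.op X))
    obtain ⟨X, hX⟩ := not_forall.1 h0
    have : Nontrivial (X ⟶ X) := ⟨⟨𝟙 X, 0, hX⟩⟩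
    have key : ∀ n : ℕ, globalDimension (GrFunctor K C) ≤ n ↔
        globalDimension (GrFunctor K Cᵒᵖ) ≤ n := by
      intro n
      rw [globalDimension_le_iff, globalDimension_le_iff]
      exact ⟨fun h => hasProjectiveDimensionLE_of_simple (GradedDuality.opposite K C).symm hC.op hC
          (X ⟶ X) fun S _ => h S,
        fun h => hasProjectiveDimensionLE_of_simple (GradedDuality.opposite K C) hC hC.op
          (X ⟶ X) fun S _ => h S⟩
    obtain ⟨a, ha⟩ := WithBot.ne_bot_iff_exists.1 h1
    obtain ⟨b, hb⟩ := WithBot.ne_bot_iff_exists.1 h2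
    rw [← ha, ← hb] at key ⊢
    congr 1
    have key' : ∀ n : ℕ, a ≤ n ↔ b ≤ n := fun n => by exact_mod_cast key n
    refine le_antisymm ?_ ?_
    · cases b with
      | top => exact le_top
      | coe m => exact (key' m).2 le_rfl
    · cases a with
      | top => exact le_top
      | coe m => exact (key' m).1 le_rfl

end

end GrFunctor

theorem mainTheorem2 (K : Type w) [Field K] (C : Type u) [Category.{v} C]
    [Preadditive C] [Linear K C] [HasFiniteBiproducts C] [EssentiallySmall.{v} C]
    [GradedLinearCategory K C]
    (hpos : IsPositivelyGraded K C) (hKS : IsKrullSchmidt K C)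
    (hrad : ∀ X Y : C, gradedRad K X Y = (positivePart K X Y : Set (X ⟶ Y))) :
    (∀ n : ℕ,
      (∀ S : GrFunctor K Cᵒᵖ, Simple S → projectiveDimension S ≤ n) →
        globalDimension (GrFunctor K C) ≤ n) ∧
    (globalDimension (GrFunctor K C) ≠ ⊤ ↔ globalDimension (GrFunctor K Cᵒᵖ) ≠ ⊤) ∧
    ((globalDimension (GrFunctor K C) ≠ ⊤ ∨ globalDimension (GrFunctor K Cᵒᵖ) ≠ ⊤) →
      globalDimension (GrFunctor K C) = globalDimension (GrFunctor K Cᵒᵖ)) := by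
  have hC := degreeZeroSemisimple hpos hKS hrad
  have heq := GrFunctor.globalDimension_op_eq hC
  refine ⟨fun n h => ?_, by rw [heq], fun _ => heq⟩
  by_cases h0 : ∀ X : C, 𝟙 X = 0
  · rw [GrFunctor.globalDimension_eq_bot_iff.2 h0]
    exact bot_le
  · obtain ⟨X, hX⟩ := not_forall.1 h0
    have : Nontrivial (X ⟶ X) := ⟨⟨𝟙 X, 0, hX⟩⟩
    exact GrFunctor.globalDimension_le_iff.2 <| GrFunctor.hasProjectiveDimensionLE_of_simple
      (GradedDuality.opposite K C) hC hC.op (X ⟶ X) fun S hS =>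
        (projectiveDimension_le_iff S n).1 (h S hS)
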